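/- Let $X$ be a complex Banach space with norm $\|\cdot\|$ and let $A:D(A)\subset X\to X$ be a sectorial linear operator, not necessarily densely defined: there are $\omega\in\mathbb R$, $\theta\in(\pi/2,\pi)$ and $M$ such that every $\lambda\neq\omega$ with $|\arg(\lambda-\omega)|<\theta$ lies in the resolvent set of $A$ and $\|(\lambda I-A)^{-1}\|\le M/|\lambda-\omega|$. Let $\mathrm e^{tA}$, $t\ge 0$, be the analytic semigroup generated by $A$, that is, $\mathrm e^{0A}=I$ and $$\mathrm e^{tA}=\frac1{2\pi \mathrm i}\int_{\omega+\gamma_{r,\eta}}\mathrm e^{t\lambda}(\lambda I-A)^{-1}\,\mathrm d\lambda,\qquad t>0,$$ where, for any $r>0$ and $\eta\in(\pi/2,\theta)$, $\gamma_{r,\eta}$ is the counterclockwise oriented curve $\{|\arg\lambda|=\eta,\ |\lambda|\ge r\}\cup\{|\arg\lambda|\le\eta,\ |\lambda|=r\}$. For $0<\alpha<1$ and $1\le p\le\infty$ let $D_A(\alpha,p)$ be the space of all $x\in X$ for which $v(t)=\|t^{1-\alpha-1/p}A\mathrm e^{tA}x\|$ is in $L^p(0,1)$, with norm $\|x\|+\|v\|_{L^p(0,1)}$,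 and let $D_A(0,p)=X$. For $0\le\alpha<1$ let $X_\alpha$, with norm $\|\cdot\|_\alpha$, be any Banach space with $D_A(\alpha,1)\subset X_\alpha\subset D_A(\alpha,\infty)$ with continuous embeddings (so that $X_0=X$ up to an equivalent norm; in particular $X_0=X$ is allowed). Let $\varphi_0(z)=\mathrm e^z$ and $\varphi_k(z)=\int_0^1\mathrm e^{(1-\xi)z}\frac{\xi^{k-1}}{(k-1)!}\,\mathrm d\xi$ for $k\ge1$; replacing $\mathrm e^{\,\cdot\, z}$ by $\mathrm e^{\,\cdot\,\tau A}$ defines $\varphi_k(\tau A)$. Let nodes $c_1,\dots,c_s\in[0,1]$ and weights $b_1,\dots,b_s$, each a finite linear combination of the functions $\varphi_k$, $k\ge0$, be given with $$\sum_{i=1}^s b_i(z)=\varphi_1(z)\qquad\text{for all } z\in\mathbb C.$$ Let $T>0$ and $B\in\mathbb R$. Then there is a constant $C$, which may depend on $A$, $X_\alpha$, $\alpha$, the method, $B$ and $T$, such that the following holds for every $g:[0,T]\to X$ that is differentiable on $(0,T]$ (from the left at $T$) with $$\|g(t)\|\le B\quad(0\le t\le T),\qquad \|g'(t)\|\le B\,t^{-1}\quad(0<t\le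 T),$$ every $u_0\in X_\alpha$, every $\tau>0$ and every integer $n\ge0$ with $t_n=n\tau\le T$. Let $$u(t)=\mathrm e^{tA}u_0+\int_0^t\mathrm e^{(t-\xi)A}g(\xi)\,\mathrm d\xi$$ be the mild solution of $u'=Au+g$, $u(0)=u_0$, and let $u_n$ be the numerical solution given by $$u_{k+1}=\mathrm e^{\tau A}u_k+\tau\sum_{i=1}^s b_i(\tau A)\,g(t_k+c_i\tau),\qquad t_k=k\tau .$$ Then $u_n$ and $u(t_n)$ belong to $X_\alpha$ and $$\|u_n-u(t_n)\|_\alpha\le C\,\tau^{1-\alpha}\bigl(|\log\tau|+1\bigr).$$ -/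

import Mathlib

open MeasureTheory Set
open scoped ENNReal

noncomputable section

namespace ExpInt

/-! ### Sectorial operators and the analytic semigroup they generate -/

section Operators

variable {X : Type*} [NormedAddCommGroup X] [NormedSpace ℂ X]

/-- `R` is the bounded two-sided inverse `(z I - A)⁻¹` of `z I - A : D(A) → X`. -/
def IsResolventAt (A : X →ₗ.[ℂ] X) (z : ℂ) (R : X →L[ℂ] X) : Prop :=
  (∀ x : X, ∃ h : R x ∈ A.domain, z • R x - A ⟨R x, h⟩ = x) ∧
    ∀ x : A.domain, R (z • (x : X) - A x) = x

/-- The resolvent set `ρ(A)`. -/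
def opResolventSet (A : X →ₗ.[ℂ] X) : Set ℂ :=
  {z | ∃ R : X →L[ℂ] X, IsResolventAt A z R}

open Classical in
/-- The resolvent `R(z, A) = (z I - A)⁻¹` for `z ∈ ρ(A)` (and `0` elsewhere). -/
def opResolvent (A : X →ₗ.[ℂ] X) (z : ℂ) : X →L[ℂ] X :=
  if h : ∃ R : X →L[ℂ] X, IsResolventAt A z R then h.choose else 0

/-- The open sector `{z ≠ ω : |arg (z - ω)| < θ}` with vertex `ω`. -/
def sector (ω θ : ℝ) : Set ℂ :=
  {z | z ≠ (ω : ℂ) ∧ |(z - (ω : ℂ)).arg| < θ}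

/-- Sectoriality of `A` with explicit constants; `D(A)` need not be dense. -/
structure IsSectorialWith (A : X →ₗ.[ℂ] X) (ω θ M : ℝ) : Prop where
  angle_gt : Real.pi / 2 < θ
  angle_lt : θ < Real.pi
  subset : sector ω θ ⊆ opResolventSet A
  bound : ∀ z ∈ sector ω θ, ‖opResolvent A z‖ ≤ M / ‖z - (ω : ℂ)‖

/-- `A` is sectorial, i.e. `A` generates an analytic semigroup (not necessarily strongly
continuous at `0`). -/
def IsSectorial (A : X →ₗ.[ℂ] X) : Prop :=
  ∃ ω θ M : ℝ, IsSectorialWith A ω θ M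

/-- The Dunford integral `(2πi)⁻¹ ∫_{ω + γ} e^{tz} R(z, A) dz`, where `γ` is the curve
`{|arg z| = η, |z| ≥ r} ∪ {|arg z| ≤ η, |z| = r}`, oriented counterclockwise, i.e. it runs from
`∞ e^{-iη}` to `∞ e^{iη}`. -/
def dunford (A : X →ₗ.[ℂ] X) (ω r η t : ℝ) : X →L[ℂ] X :=
  (2 * (Real.pi : ℂ) * Complex.I)⁻¹ •
    (-(∫ ρ in Ioi r,
        (Complex.exp (t * (ω + ρ * Complex.exp (-(η * Complex.I)))) *
            Complex.exp (-(η * Complex.I))) •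
          opResolvent A (ω + ρ * Complex.exp (-(η * Complex.I)))) +
      (∫ φ in (-η)..η,
        (Complex.exp (t * (ω + r * Complex.exp (φ * Complex.I))) *
            (Complex.I * r * Complex.exp (φ * Complex.I))) •
          opResolvent A (ω + r * Complex.exp (φ * Complex.I))) +
      ∫ ρ in Ioi r,
        (Complex.exp (t * (ω + ρ * Complex.exp (η * Complex.I))) *
            Complex.exp (η * Complex.I)) •
          opResolvent A (ω + ρ * Complex.exp (η * Complex.I)))

open Classical in
/-- The analytic semigroup `e^{tA}`, `t ≥ 0`, generated by a sectorial operator `A`: the identity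
for `t = 0` and the Dunford integral for `t > 0`. The integral does not depend on the choice of
`ω`, `r > 0` and `η ∈ (π/2, θ)`; we take `r = 1`, `η = (θ + π/2)/2` for some admissible
`ω`, `θ`. (For `t < 0` or a non-sectorial operator the value is irrelevant.) -/
def semigroup (A : X →ₗ.[ℂ] X) (t : ℝ) : X →L[ℂ] X :=
  if t = 0 then ContinuousLinearMap.id ℂ X
  else if h : IsSectorial A then
    dunford A h.choose 1 ((h.choose_spec.choose + Real.pi / 2) / 2) t
  else 0

/-! ### Real interpolation spaces `D_A(α, p)` and intermediate spaces `X_α` -/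

open Classical in
/-- `A x` for `x ∈ D(A)`, and `0` otherwise (it is only used for `x = e^{tA} y` with `t > 0`,
which always belongs to `D(A)`). -/
def opApply (A : X →ₗ.[ℂ] X) (x : X) : X :=
  if h : x ∈ A.domain then A ⟨x, h⟩ else 0

/-- The function `v(t) = ‖t^{1 - α - 1/p} A e^{tA} x‖`. -/
def interpFun (A : X →ₗ.[ℂ] X) (α : ℝ) (p : ℝ≥0∞) (x : X) (t : ℝ) : ℝ :=
  t ^ (1 - α - (p⁻¹).toReal) * ‖opApply A (semigroup A t x)‖

/-- The set `D_A(α, p)`: `X` itself for `α = 0`, and all `x` with `v ∈ L^p(0,1)` for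
`0 < α < 1`. -/
def interpSpace (A : X →ₗ.[ℂ] X) (α : ℝ) (p : ℝ≥0∞) : Set X :=
  {x | α = 0 ∨ MemLp (interpFun A α p x) p (volume.restrict (Ioo (0 : ℝ) 1))}

/-- The norm of `D_A(α, p)`: `‖x‖` for `α = 0`, and `‖x‖ + ‖v‖_{L^p(0,1)}` for `0 < α < 1`. -/
def interpNorm (A : X →ₗ.[ℂ] X) (α : ℝ) (p : ℝ≥0∞) (x : X) : ℝ :=
  if α = 0 then ‖x‖
  else ‖x‖ + (eLpNorm (interpFun A α p x) p (volume.restrict (Ioo (0 : ℝ) 1))).toReal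

/-- The space `Y`, regarded through `ι` as a linear subspace of `X` with its own norm, is an
intermediate space `X_α`: `D_A(α, 1) ⊂ X_α ⊂ D_A(α, ∞)` with continuous embeddings. -/
structure IsIntermediate (A : X →ₗ.[ℂ] X) (α : ℝ) {Y : Type*} [NormedAddCommGroup Y]
    [NormedSpace ℂ Y] (ι : Y →ₗ[ℂ] X) : Prop where
  injective : Function.Injective ι
  lower : ∃ C : ℝ, ∀ x ∈ interpSpace A α 1, ∃ y : Y, ι y = x ∧ ‖y‖ ≤ C * interpNorm A α 1 x
  upper : ∃ C : ℝ, ∀ y : Y, ι y ∈ interpSpace A α ∞ ∧ interpNorm A α ∞ (ι y) ≤ C * ‖y‖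

/-- The mild solution `u(t) = e^{tA} u₀ + ∫₀ᵗ e^{(t-ξ)A} g(ξ) dξ` of `u' = Au + g`,
`u(0) = u₀`. -/
def mildSolution (A : X →ₗ.[ℂ] X) (g : ℝ → X) (u₀ : X) (t : ℝ) : X :=
  semigroup A t u₀ + ∫ ξ in (0 : ℝ)..t, semigroup A (t - ξ) (g ξ)

end Operators

/-! ### Exponential Runge–Kutta methods -/

/-- The functions `φ₀(z) = e^z`,
`φ_k(z) = ∫₀¹ e^{(1-ξ)z} ξ^{k-1}/(k-1)! dξ` for `k ≥ 1`. -/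
def phi : ℕ → ℂ → ℂ
  | 0, z => Complex.exp z
  | k + 1, z => ∫ ξ in (0 : ℝ)..1, Complex.exp ((1 - ξ) * z) * ((ξ ^ k / (k.factorial : ℝ) : ℝ) : ℂ)

/-- The coefficients of an `s`-stage exponential Runge–Kutta method for linear problems: nodes
`c_i ∈ [0,1]`, and for each weight `b_i` the finitely many coefficients of `b_i` as a linear
combination of `φ₀, φ₁, φ₂, …`. -/
structure Method (s : ℕ) where
  c : Fin s → ℝ
  c_mem : ∀ i, c i ∈ Icc (0 : ℝ) 1
  coeff : Fin s → ℕ →₀ ℂ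

/-- The weight `b_i(z)`. -/
def Method.b {s : ℕ} (m : Method s) (i : Fin s) (z : ℂ) : ℂ :=
  (m.coeff i).sum fun k a => a * phi k z

section Scheme

variable {X : Type*} [NormedAddCommGroup X] [NormedSpace ℂ X]

/-- The operators `φ_k(τA)`. -/
def phiOp (A : X →ₗ.[ℂ] X) (τ : ℝ) : ℕ → X →L[ℂ] X
  | 0 => semigroup A τ
  | k + 1 => ∫ ξ in (0 : ℝ)..1,
      ((ξ ^ k / (k.factorial : ℝ) : ℝ) : ℂ) • semigroup A ((1 - ξ) * τ)

/-- The operator `b_i(τA)`. -/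
def Method.bOp {s : ℕ} (m : Method s) (A : X →ₗ.[ℂ] X) (τ : ℝ) (i : Fin s) : X →L[ℂ] X :=
  (m.coeff i).sum fun k a => a • phiOp A τ k

/-- The numerical solution
`u_{n+1} = e^{τA} u_n + τ ∑ᵢ b_i(τA) g(t_n + c_i τ)`, `t_n = nτ`, started at `u₀`. -/
def Method.numSol {s : ℕ} (m : Method s) (A : X →ₗ.[ℂ] X) (g : ℝ → X) (u₀ : X) (τ : ℝ) : ℕ → X
  | 0 => u₀
  | n + 1 => semigroup A τ (m.numSol A g u₀ τ n) +
      τ • ∑ i : Fin s, m.bOp A τ i (g (n * τ + m.c i * τ))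

end Scheme

end ExpInt

end

/-!
The error of the exponential Runge–Kutta method is a sum of propagated local errors,
`u_n - u(t_n) = ∑_{k<n} e^{(n-1-k)τA} δ_k`. Since `∑ b_i = φ₁`, the method is exact for constant
forcing, so `δ_k` only involves the differences of `g` from the value `g(t_{k+1})`. These are
`O(1/(k+1))` because `‖g'(t)‖ ≤ B/t` for `k ≥ 1` and because `g` is bounded for `k = 0`, whence
`‖δ_k‖ = O(τ/(k+1))` in `X` (`Method.exists_norm_localError_le`). For `k < n - 1` the smoothing
property `‖e^{σA} x‖_α = O(σ^{-α}) ‖x‖` with `σ ≥ τ` gives a contribution `O(τ^{1-α}/(k+1))`, and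
the harmonic sum produces the logarithm. The last local error is not smoothed; it is `O(τ^{1-α})` in
the intermediate space directly, since `∫₀^τ e^{σA} f(σ) dσ` is for bounded `f`
(`Method.exists_hasLift_localError`). Both estimates reduce to one bound in `D_A(α, 1)`,
`IsAnalyticSemigroup.exists_hasLift_of_bound`, and to `‖A e^{tA}‖ = O(1/t)`.

The facts on the semigroup are derived from the Dunford integral. With the vertex of the sector
moved to the origin, `F(z) = R(ω + z, A)` is a function with values in the Banach algebra of
bounded operators which satisfies the resolvent identity and `‖F(z)‖ ≤ M/|z|`; nothing else is
needed (`IsSectorialFamily`). Choosing the contour radius `1/t`, which is permitted by Cauchy's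
theorem (`contourInt_eq_of_radius`), yields the bounds on `E(t) = e^{tA}` and `E'(t)` (for `ω = 0`).
The resolvent identity and `∫_γ e^{tz} dz = 0` give `E(t) = F(1) (E(t) - E'(t))`, so `E(t)` maps into
the domain and `E' = A E`. The semigroup law follows because `σ ↦ E(t-σ) E(s+σ)` has derivative zero
and tends to `E(s+t)` as `σ → t`; the latter rests on Hankel's integral `∫_γ e^{tz} z⁻¹ dz = 2πi`.

The transfer of `∑ b_i = φ₁` from scalars to operators uses that the functions `φ_k` are linearly
independent, which is visible from `φ_k(x) ~ x^{-k} e^x` as `x → ∞`.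
-/

noncomputable section

namespace ExpInt

/-! ### Integrals over the sectorial contour -/

section Contour

variable {E : Type*} [NormedAddCommGroup E] [NormedSpace ℂ E]

/-- The unit complex number `e^{iψ}`. -/
def cis (ψ : ℝ) : ℂ := Complex.exp (ψ * Complex.I)

lemma norm_cis (ψ : ℝ) : ‖cis ψ‖ = 1 := Complex.norm_exp_ofReal_mul_I ψ

lemma cis_ne_zero (ψ : ℝ) : cis ψ ≠ 0 := Complex.exp_ne_zero _

lemma cis_re (ψ : ℝ) : (cis ψ).re = Real.cos ψ := Complex.exp_ofReal_mul_I_re ψ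

lemma continuous_cis : Continuous cis := by unfold cis; fun_prop

lemma hasDerivAt_cis (ψ : ℝ) : HasDerivAt cis (cis ψ * Complex.I) ψ := by
  have h : HasDerivAt (fun x : ℝ => (x : ℂ) * Complex.I) (1 * Complex.I) ψ :=
    (Complex.ofRealCLM.hasDerivAt (x := ψ)).mul_const Complex.I
  have h2 := h.cexp
  rw [one_mul] at h2
  exact h2

/-- The open sector of half-angle `θ` with vertex at the origin. -/
def csector (θ : ℝ) : Set ℂ := {z | z ≠ 0 ∧ |z.arg| < θ}

lemma isOpen_csector {θ : ℝ} (hθ : θ < Real.pi) : IsOpen (csector θ) := by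
  rw [isOpen_iff_mem_nhds]
  rintro z ⟨hz, hzθ⟩
  have hs : z ∈ Complex.slitPlane := by
    rw [Complex.mem_slitPlane_iff_arg]
    refine ⟨fun h => ?_, hz⟩
    rw [h, abs_of_pos Real.pi_pos] at hzθ
    exact lt_asymm hθ hzθ
  have h1 := (Complex.continuousAt_arg hs).abs.eventually (gt_mem_nhds hzθ)
  filter_upwards [h1, isOpen_ne.mem_nhds hz] with w hw hw0 using ⟨hw0, hw⟩

lemma mul_cis_mem_csector {θ : ℝ} (hθ : θ < Real.pi) {ρ ψ : ℝ} (hρ : 0 < ρ) (hψ : |ψ| < θ) :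
    (ρ : ℂ) * cis ψ ∈ csector θ := by
  refine ⟨mul_ne_zero (by exact_mod_cast hρ.ne') (cis_ne_zero ψ), ?_⟩
  have h := abs_lt.1 hψ
  rw [cis, Complex.exp_mul_I, Complex.arg_mul_cos_add_sin_mul_I hρ ⟨by linarith, by linarith⟩]
  exact hψ

lemma norm_mul_cis {ρ : ℝ} (hρ : 0 ≤ ρ) (ψ : ℝ) : ‖(ρ : ℂ) * cis ψ‖ = ρ := by
  simp [norm_cis, abs_of_nonneg hρ]

lemma norm_exp_mul_mul_cis (t ρ ψ : ℝ) :
    ‖Complex.exp (t * (ρ * cis ψ))‖ = Real.exp (t * Real.cos ψ * ρ) := by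
  rw [Complex.norm_exp]
  congr 1
  rw [← mul_assoc, ← Complex.ofReal_mul, Complex.re_ofReal_mul, cis_re]
  ring

/-- The integral of `G` over the ray `{ρ e^{iψ} : ρ > r}`, oriented towards infinity. -/
def rayInt (r ψ : ℝ) (G : ℂ → E) : E := ∫ ρ in Ioi r, cis ψ • G (ρ * cis ψ)

/-- The integral of `G` over the arc `{r e^{iφ} : |φ| ≤ η}`, oriented counterclockwise. -/
def arcInt (r η : ℝ) (G : ℂ → E) : E :=
  ∫ φ in (-η)..η, (Complex.I * r * cis φ) • G (r * cis φ)

/-- The integral of `G` over the contour `γ_{r,η}`, which runs from `∞ e^{-iη}` to `∞ e^{iη}`. -/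
def contourInt (r η : ℝ) (G : ℂ → E) : E := -rayInt r (-η) G + arcInt r η G + rayInt r η G

/-- `P` is holomorphic on the sector and bounded on its part outside every disc around `0`. The
weighted functions `e^{tz} P(z)`, `t > 0`, are then integrable over the contours `γ_{r,η}`. -/
structure ContourAdmissible (θ : ℝ) (P : ℂ → E) : Prop where
  diff : DifferentiableOn ℂ P (csector θ)
  bdd : ∀ r > 0, ∃ Q, ∀ z ∈ csector θ, r ≤ ‖z‖ → ‖P z‖ ≤ Q

lemma continuousOn_ray {F : Type*} [TopologicalSpace F] {θ : ℝ} (hθ : θ < Real.pi) {P : ℂ → F}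
    (hP : ContinuousOn P (csector θ))
    {ψ : ℝ} (hψ : |ψ| < θ) : ContinuousOn (fun ρ : ℝ => P (ρ * cis ψ)) (Ioi 0) :=
  hP.comp (by fun_prop) fun _ hρ => mul_cis_mem_csector hθ hρ hψ

lemma continuousOn_arc {F : Type*} [TopologicalSpace F] {θ : ℝ} (hθ : θ < Real.pi) {P : ℂ → F}
    (hP : ContinuousOn P (csector θ))
    {r η : ℝ} (hr : 0 < r) (hη : η < θ) :
    ContinuousOn (fun φ : ℝ => P (r * cis φ)) (Icc (-η) η) := by
  refine hP.comp (continuous_const.mul continuous_cis).continuousOn fun φ hφ => ?_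
  exact mul_cis_mem_csector hθ hr ((abs_le.2 hφ).trans_lt hη)

/-- Bound for the exponentially weighted integral over a ray in the left half-plane. -/
lemma norm_rayInt_le {r ψ t Q : ℝ} (hψ : Real.cos ψ < 0) (ht : 0 < t) (hr : 0 ≤ r) (hQ : 0 ≤ Q)
    {P : ℂ → E} (hP : ∀ ρ > r, ‖P (ρ * cis ψ)‖ ≤ Q) :
    ‖rayInt r ψ fun z => Complex.exp (t * z) • P z‖ ≤ Q / t * (1 / (-Real.cos ψ)) := by
  have hneg : t * Real.cos ψ < 0 := mul_neg_of_pos_of_neg ht hψ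
  have hint := (integrableOn_exp_mul_Ioi hneg r).mul_const Q
  have h1 : ‖rayInt r ψ fun z => Complex.exp (t * z) • P z‖ ≤
      ∫ ρ in Ioi r, Real.exp (t * Real.cos ψ * ρ) * Q := by
    refine norm_integral_le_of_norm_le hint ?_
    filter_upwards [ae_restrict_mem measurableSet_Ioi] with ρ hρ
    rw [norm_smul, norm_cis, one_mul, norm_smul, norm_exp_mul_mul_cis]
    exact mul_le_mul_of_nonneg_left (hP ρ hρ) (Real.exp_pos _).le
  rw [integral_mul_const, integral_exp_mul_Ioi hneg] at h1
  refine h1.trans ?_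
  have h2 : Real.exp (t * Real.cos ψ * r) ≤ 1 :=
    Real.exp_le_one_iff.2 (mul_nonpos_of_nonpos_of_nonneg hneg.le hr)
  have h3 : -Real.exp (t * Real.cos ψ * r) / (t * Real.cos ψ) * Q =
      Q / t * (1 / (-Real.cos ψ)) * Real.exp (t * Real.cos ψ * r) := by
    have := hψ.ne
    field_simp
  rw [h3]
  refine mul_le_of_le_one_right ?_ h2
  have : 0 < -Real.cos ψ := by linarith
  positivity

/-- On the contour of radius `1/t` the integral of `e^{tz} P(z)` is bounded by `sup ‖P‖ / t`: the
exponential is bounded on the arc of length `O(1/t)` and decays at rate `t` on the rays. -/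
lemma exists_norm_contourInt_le {η : ℝ} (hη : 0 < η) (hc : Real.cos η < 0) :
    ∃ C : ℝ, 0 ≤ C ∧ ∀ (P : ℂ → E) (t Q : ℝ), 0 < t →
      (∀ ρ ψ : ℝ, 1 / t ≤ ρ → |ψ| ≤ η → ‖P (ρ * cis ψ)‖ ≤ Q) →
      ‖contourInt (1 / t) η fun z => Complex.exp (t * z) • P z‖ ≤ C * (Q / t) := by
  refine ⟨2 * (1 / (-Real.cos η)) + Real.exp 1 * (2 * η), ?_, ?_⟩
  · have : 0 < -Real.cos η := by linarith
    positivity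
  intro P t Q ht hP
  have hr : 0 < 1 / t := by positivity
  have hQ : 0 ≤ Q := (norm_nonneg _).trans (hP (1 / t) 0 le_rfl (by simpa using hη.le))
  have h1 := norm_rayInt_le (P := P) (r := 1 / t) (ψ := η) hc ht hr.le hQ
    fun ρ hρ => hP ρ η (le_of_lt hρ) (abs_of_pos hη).le
  have h2 := norm_rayInt_le (P := P) (r := 1 / t) (ψ := -η) (by rwa [Real.cos_neg]) ht hr.le hQ
    fun ρ hρ => hP ρ (-η) (le_of_lt hρ) (by rw [abs_neg, abs_of_pos hη])
  rw [Real.cos_neg] at h2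
  have h3 : ‖arcInt (1 / t) η fun z => Complex.exp (t * z) • P z‖ ≤
      1 / t * (Real.exp 1 * Q) * |η - -η| := by
    refine intervalIntegral.norm_integral_le_of_norm_le_const fun φ hφ => ?_
    rw [uIoc_of_le (by linarith)] at hφ
    rw [norm_smul, norm_smul, norm_exp_mul_mul_cis, norm_mul, norm_mul, Complex.norm_I, one_mul,
      norm_cis, mul_one, Complex.norm_real, Real.norm_of_nonneg hr.le]
    have h4 : t * Real.cos φ * (1 / t) ≤ 1 := by
      rw [mul_comm t, mul_assoc, mul_one_div_cancel ht.ne', mul_one]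
      exact Real.cos_le_one φ
    refine mul_le_mul_of_nonneg_left ?_ hr.le
    exact mul_le_mul (Real.exp_le_exp.2 h4) (hP _ _ le_rfl (abs_le.2 ⟨hφ.1.le, hφ.2⟩))
      (norm_nonneg _) (Real.exp_pos _).le
  rw [show |η - -η| = 2 * η by rw [sub_neg_eq_add, ← two_mul, abs_of_pos (by positivity)]] at h3
  rw [contourInt]
  refine (norm_add₃_le).trans ?_
  rw [norm_neg]
  refine (add_le_add (add_le_add h2 h3) h1).trans (le_of_eq ?_)
  ring

lemma integrableOn_rayInt {θ : ℝ} (hθ : θ < Real.pi) {P : ℂ → E} (hP : ContourAdmissible θ P)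
    {r ψ t : ℝ} (hr : 0 < r) (hψ : |ψ| < θ) (hc : Real.cos ψ < 0) (ht : 0 < t) :
    IntegrableOn (fun ρ : ℝ => cis ψ • (Complex.exp (t * (ρ * cis ψ)) • P (ρ * cis ψ)))
      (Ioi r) := by
  obtain ⟨Q, hQ⟩ := hP.bdd r hr
  have hint := (integrableOn_exp_mul_Ioi (mul_neg_of_pos_of_neg ht hc) r).mul_const Q
  refine Integrable.mono' hint ?_ ?_
  · refine ContinuousOn.aestronglyMeasurable ?_ measurableSet_Ioi
    refine ContinuousOn.const_smul (ContinuousOn.smul (by fun_prop) ?_) _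
    exact (continuousOn_ray hθ hP.diff.continuousOn hψ).mono (Ioi_subset_Ioi hr.le)
  · filter_upwards [ae_restrict_mem measurableSet_Ioi] with ρ hρ
    have hρ0 : 0 < ρ := hr.trans hρ
    rw [norm_smul, norm_cis, one_mul, norm_smul, norm_exp_mul_mul_cis]
    refine mul_le_mul_of_nonneg_left (hQ _ (mul_cis_mem_csector hθ hρ0 hψ) ?_) (Real.exp_pos _).le
    rw [norm_mul_cis hρ0.le]
    exact le_of_lt hρ

/-- In logarithmic coordinates an integral along a ray becomes one along a horizontal line. -/
lemma integral_exp_smul_ray {G : ℂ → E} {ψ r₁ r₂ : ℝ} (h₁ : 0 < r₁) (h₂ : 0 < r₂)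
    (hG : ContinuousOn (fun ρ : ℝ => G (ρ * cis ψ)) (Ioi 0)) :
    ∫ x in Real.log r₁..Real.log r₂,
        Complex.exp (x + ψ * Complex.I) • G (Complex.exp (x + ψ * Complex.I)) =
      ∫ ρ in r₁..r₂, cis ψ • G (ρ * cis ψ) := by
  have h := intervalIntegral.integral_deriv_smul_comp' (a := Real.log r₁) (b := Real.log r₂)
    (f := Real.exp) (f' := Real.exp) (g := fun ρ : ℝ => cis ψ • G (ρ * cis ψ))
    (fun x _ => Real.hasDerivAt_exp x) Real.continuous_exp.continuousOn
    ((hG.const_smul _).mono (by rintro _ ⟨x, -, rfl⟩; exact Real.exp_pos x))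
  rw [Real.exp_log h₁, Real.exp_log h₂] at h
  rw [← h]
  refine intervalIntegral.integral_congr fun x _ => ?_
  simp only [Function.comp, Complex.exp_add, Complex.ofReal_exp]
  rw [← Complex.coe_smul, Complex.ofReal_exp, smul_smul]
  rfl

/-- Contour deformation: the contour integral does not depend on the radius. This is Cauchy's
theorem on an annular sector, which is a rectangle in logarithmic coordinates. -/
lemma contourInt_eq_of_radius [CompleteSpace E] {θ η : ℝ} (hθ : θ < Real.pi) (hη : 0 < η)
    (hηθ : η < θ) {G : ℂ → E} (hG : DifferentiableOn ℂ G (csector θ))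
    (hint : ∀ ψ : ℝ, |ψ| = η → ∀ r > 0, IntegrableOn (fun ρ : ℝ => cis ψ • G (ρ * cis ψ)) (Ioi r))
    {r₁ r₂ : ℝ} (h₁ : 0 < r₁) (h₂ : 0 < r₂) : contourInt r₁ η G = contourInt r₂ η G := by
  have hray (ψ : ℝ) (hψ : |ψ| = η) :=
    continuousOn_ray hθ hG.continuousOn (ψ := ψ) (by rwa [hψ])
  have hmem : ∀ w : ℂ, |w.im| ≤ η → Complex.exp w ∈ csector θ := by
    intro w hw
    have := mul_cis_mem_csector hθ (Real.exp_pos w.re) (hw.trans_lt hηθ)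
    rwa [cis, Complex.ofReal_exp, ← Complex.exp_add, Complex.re_add_im] at this
  have hrect := Complex.integral_boundary_rect_eq_zero_of_differentiableOn
    (fun w => Complex.exp w • G (Complex.exp w)) (⟨Real.log r₁, -η⟩ : ℂ) ⟨Real.log r₂, η⟩ (by
      refine DifferentiableOn.smul (by fun_prop) (hG.comp (by fun_prop) fun w hw => hmem w ?_)
      have h := hw.2
      simp only [mem_preimage] at h
      rw [uIcc_of_le (by linarith)] at h
      exact abs_le.2 h)
  simp only at hrect
  rw [integral_exp_smul_ray h₁ h₂ (hray _ (by rw [abs_neg, abs_of_pos hη])),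
    integral_exp_smul_ray h₁ h₂ (hray _ (abs_of_pos hη))] at hrect
  have harc (r : ℝ) (hr : 0 < r) : (Complex.I • ∫ y in (-η)..η,
      Complex.exp ((Real.log r : ℝ) + y * Complex.I) •
        G (Complex.exp ((Real.log r : ℝ) + y * Complex.I))) = arcInt r η G := by
    rw [arcInt, ← intervalIntegral.integral_smul]
    refine intervalIntegral.integral_congr fun y _ => ?_
    simp only [Complex.exp_add, ← Complex.ofReal_exp, Real.exp_log hr, smul_smul, cis, mul_assoc]
  rw [harc r₁ h₁, harc r₂ h₂] at hrect
  have hsplit (ψ : ℝ) (hψ : |ψ| = η) := intervalIntegral.integral_interval_add_Ioi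
    (hint ψ hψ r₁ h₁) (hint ψ hψ r₂ h₂)
  rw [contourInt, contourInt, rayInt, rayInt, rayInt, rayInt,
    ← hsplit (-η) (by rw [abs_neg, abs_of_pos hη]), ← hsplit η (abs_of_pos hη)]
  rw [← sub_eq_zero, ← neg_eq_zero, ← hrect]
  abel

/-- Differentiation of `t ↦ ∫_γ e^{tz} P(z) dz` under the integral sign. -/
lemma hasDerivAt_contourInt [CompleteSpace E] {θ η : ℝ} (hθ : θ < Real.pi) (hη : 0 < η)
    (hηθ : η < θ) (hc : Real.cos η < 0) {P : ℂ → E} (hP : ContourAdmissible θ P)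
    {r t : ℝ} (hr : 0 < r) (ht : 0 < t) :
    HasDerivAt (fun t : ℝ => contourInt r η fun z => Complex.exp (t * z) • P z)
      (contourInt r η fun z => Complex.exp (t * z) • (z • P z)) t := by
  have hexp (z : ℂ) (x : ℝ) : HasDerivAt (fun t : ℝ => Complex.exp (t * z) • P z)
      (Complex.exp (x * z) • (z • P z)) x := by
    have h : HasDerivAt (fun x : ℝ => (x : ℂ) * z) (1 * z) x :=
      (Complex.ofRealCLM.hasDerivAt (x := x)).mul_const z
    simpa [smul_smul] using h.cexp.smul_const (P z)
  obtain ⟨Q, hQ⟩ := hP.bdd r hr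
  have hrayder (ψ : ℝ) (hψ : |ψ| < θ) (hcψ : Real.cos ψ < 0) :
      HasDerivAt (fun t : ℝ => rayInt r ψ fun z => Complex.exp (t * z) • P z)
        (rayInt r ψ fun z => Complex.exp (t * z) • (z • P z)) t := by
    have hcont : ContinuousOn (fun ρ : ℝ => P (ρ * cis ψ)) (Ioi r) :=
      (continuousOn_ray hθ hP.diff.continuousOn hψ).mono (Ioi_subset_Ioi hr.le)
    -- On `x > t/2` the factor `ρ` is absorbed by half of the exponential decay.
    have hneg : t / 4 * Real.cos ψ < 0 := mul_neg_of_pos_of_neg (by positivity) hcψ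
    have hint := ((integrableOn_exp_mul_Ioi hneg r).const_mul
      (1 / (-(t / 4 * Real.cos ψ)))).mul_const Q
    refine (hasDerivAt_integral_of_dominated_loc_of_deriv_le (s := Ioi (t / 2)) (x₀ := t)
      (F := fun (x ρ : ℝ) => cis ψ • (Complex.exp (x * (ρ * cis ψ)) • P (ρ * cis ψ)))
      (Ioi_mem_nhds (by linarith)) (.of_forall fun x => ?_)
      (integrableOn_rayInt hθ hP hr hψ hcψ ht)
      (F' := fun (x ρ : ℝ) =>
        cis ψ • (Complex.exp (x * (ρ * cis ψ)) • ((ρ * cis ψ) • P (ρ * cis ψ))))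
      ?_ ?_ hint (.of_forall fun ρ x _ => (hexp _ x).const_smul _)).2
    · exact ContinuousOn.aestronglyMeasurable
        (ContinuousOn.const_smul (ContinuousOn.smul (by fun_prop) hcont) _) measurableSet_Ioi
    · exact ContinuousOn.aestronglyMeasurable (ContinuousOn.const_smul (ContinuousOn.smul
        (by fun_prop) (ContinuousOn.smul (by fun_prop) hcont)) _) measurableSet_Ioi
    · filter_upwards [ae_restrict_mem measurableSet_Ioi] with ρ hρ x hx
      have hρ0 : 0 < ρ := hr.trans hρ
      have hx' : t / 2 < x := hx
      rw [norm_smul, norm_cis, one_mul, norm_smul, norm_exp_mul_mul_cis, norm_smul,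
        norm_mul_cis hρ0.le, ← mul_assoc]
      have hP' : ‖P (ρ * cis ψ)‖ ≤ Q :=
        hQ _ (mul_cis_mem_csector hθ hρ0 hψ) (by rw [norm_mul_cis hρ0.le]; exact le_of_lt hρ)
      refine mul_le_mul ?_ hP' (norm_nonneg _) ?_
      · have hd : 0 < -(t / 4 * Real.cos ψ) := by linarith
        have h1 : Real.exp (x * Real.cos ψ * ρ) ≤
            Real.exp (t / 4 * Real.cos ψ * ρ) * Real.exp (t / 4 * Real.cos ψ * ρ) := by
          rw [← Real.exp_add]
          refine Real.exp_le_exp.2 ?_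
          have : (x - t / 2) * (Real.cos ψ * ρ) ≤ 0 :=
            mul_nonpos_of_nonneg_of_nonpos (by linarith)
              (mul_nonpos_of_nonpos_of_nonneg hcψ.le hρ0.le)
          nlinarith
        have h2 : Real.exp (t / 4 * Real.cos ψ * ρ) * ρ ≤ 1 / (-(t / 4 * Real.cos ψ)) := by
          rw [le_div_iff₀ hd]
          have h3 := Real.add_one_le_exp (-(t / 4 * Real.cos ψ) * ρ)
          calc Real.exp (t / 4 * Real.cos ψ * ρ) * ρ * -(t / 4 * Real.cos ψ)
              = Real.exp (t / 4 * Real.cos ψ * ρ) * (-(t / 4 * Real.cos ψ) * ρ) := by ring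
            _ ≤ Real.exp (t / 4 * Real.cos ψ * ρ) * Real.exp (-(t / 4 * Real.cos ψ) * ρ) :=
              mul_le_mul_of_nonneg_left (by linarith) (Real.exp_pos _).le
            _ = 1 := by rw [← Real.exp_add]; ring_nf; exact Real.exp_zero
        calc Real.exp (x * Real.cos ψ * ρ) * ρ
            ≤ Real.exp (t / 4 * Real.cos ψ * ρ) * Real.exp (t / 4 * Real.cos ψ * ρ) * ρ :=
              mul_le_mul_of_nonneg_right h1 hρ0.le
          _ = Real.exp (t / 4 * Real.cos ψ * ρ) * ρ * Real.exp (t / 4 * Real.cos ψ * ρ) := by ring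
          _ ≤ _ := mul_le_mul_of_nonneg_right h2 (Real.exp_pos _).le
      · have : 0 < -(t / 4 * Real.cos ψ) := by linarith
        positivity
  have harcder : HasDerivAt (fun t : ℝ => arcInt r η fun z => Complex.exp (t * z) • P z)
      (arcInt r η fun z => Complex.exp (t * z) • (z • P z)) t := by
    have hcont := continuousOn_arc hθ hP.diff.continuousOn hr hηθ
    have hle : -η ≤ η := by linarith
    have hcis := continuous_cis
    have hF (x : ℝ) : ContinuousOn (fun φ : ℝ => (Complex.I * r * cis φ) •
        (Complex.exp (x * (r * cis φ)) • P (r * cis φ))) (Icc (-η) η) :=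
      ContinuousOn.smul (by fun_prop) (ContinuousOn.smul (by fun_prop) hcont)
    have hF' : ContinuousOn (fun φ : ℝ => (Complex.I * r * cis φ) •
        (Complex.exp (t * (r * cis φ)) • ((r * cis φ) • P (r * cis φ)))) (Icc (-η) η) :=
      ContinuousOn.smul (by fun_prop) (ContinuousOn.smul (by fun_prop)
        (ContinuousOn.smul (by fun_prop) hcont))
    have hsub : uIoc (-η) η ⊆ Icc (-η) η := by
      rw [uIoc_of_le hle]; exact Ioc_subset_Icc_self
    refine (intervalIntegral.hasDerivAt_integral_of_dominated_loc_of_deriv_le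
      (s := Ioo (t - 1) (t + 1)) (bound := fun _ => r * (Real.exp ((|t| + 1) * r) * (r * Q)))
      (Ioo_mem_nhds (by linarith) (by linarith)) (.of_forall fun x => ?_) ?_
      (F' := fun (x : ℝ) φ => (Complex.I * r * cis φ) •
        (Complex.exp (x * (r * cis φ)) • ((r * cis φ) • P (r * cis φ))))
      ?_ (.of_forall fun φ hφ x hx => ?_) intervalIntegrable_const
      (.of_forall fun φ _ x _ => (hexp _ x).const_smul _)).2
    · exact ((hF x).mono hsub).aestronglyMeasurable measurableSet_uIoc
    · exact (hF t).intervalIntegrable_of_Icc hle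
    · exact (hF'.mono hsub).aestronglyMeasurable measurableSet_uIoc
    · have hφ' : |φ| < θ := (abs_le.2 (hsub hφ)).trans_lt hηθ
      rw [norm_smul, norm_smul, norm_exp_mul_mul_cis, norm_mul, norm_mul, Complex.norm_I, one_mul,
        norm_cis, mul_one, Complex.norm_real, Real.norm_of_nonneg hr.le, norm_smul,
        norm_mul_cis hr.le]
      have h1 : x * Real.cos φ * r ≤ (|t| + 1) * r := by
        refine mul_le_mul_of_nonneg_right ?_ hr.le
        have h2 : |x| ≤ |t| + 1 := by
          have := abs_sub_abs_le_abs_sub x t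
          have h3 : |x - t| < 1 := abs_lt.2 ⟨by linarith [hx.1], by linarith [hx.2]⟩
          linarith
        calc x * Real.cos φ ≤ |x * Real.cos φ| := le_abs_self _
          _ = |x| * |Real.cos φ| := abs_mul _ _
          _ ≤ |x| * 1 := mul_le_mul_of_nonneg_left (Real.abs_cos_le_one φ) (abs_nonneg _)
          _ ≤ _ := by linarith
      have h4 := hQ _ (mul_cis_mem_csector hθ hr hφ') (by rw [norm_mul_cis hr.le])
      gcongr
  have hη' : |η| < θ := by rwa [abs_of_pos hη]
  exact ((hrayder (-η) (by rwa [abs_neg]) (by rwa [Real.cos_neg])).neg.add harcder).add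
    (hrayder η hη' hc)

end Contour

/-! ### Calculus of contour integrals and Hankel's integral -/

section ContourCalculus

variable {E : Type*} [NormedAddCommGroup E] [NormedSpace ℂ E]

/-- `G` is integrable over the contour `γ_{r,η}`. -/
structure ContourIntegrable (r η : ℝ) (G : ℂ → E) : Prop where
  lower : IntegrableOn (fun ρ : ℝ => cis (-η) • G (ρ * cis (-η))) (Ioi r)
  arc : IntervalIntegrable (fun φ : ℝ => (Complex.I * r * cis φ) • G (r * cis φ)) volume (-η) η
  upper : IntegrableOn (fun ρ : ℝ => cis η • G (ρ * cis η)) (Ioi r)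

lemma ContourAdmissible.contourIntegrable {θ η : ℝ} (hθ : θ < Real.pi) (hη : 0 < η)
    (hηθ : η < θ) (hc : Real.cos η < 0) {P : ℂ → E} (hP : ContourAdmissible θ P)
    {r t : ℝ} (hr : 0 < r) (ht : 0 < t) :
    ContourIntegrable r η fun z => Complex.exp (t * z) • P z := by
  have hη' : |η| < θ := by rwa [abs_of_pos hη]
  have hcis := continuous_cis
  refine ⟨integrableOn_rayInt hθ hP hr (by rwa [abs_neg]) (by rwa [Real.cos_neg]) ht,
    ContinuousOn.intervalIntegrable_of_Icc (by linarith) ?_, integrableOn_rayInt hθ hP hr hη' hc ht⟩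
  exact ContinuousOn.smul (by fun_prop) (ContinuousOn.smul (by fun_prop)
    (continuousOn_arc hθ hP.diff.continuousOn hr hηθ))

lemma ContourIntegrable.add {r η : ℝ} {G H : ℂ → E} (hG : ContourIntegrable r η G)
    (hH : ContourIntegrable r η H) : ContourIntegrable r η fun z => G z + H z := by
  refine ⟨?_, ?_, ?_⟩ <;> simp only [smul_add]
  exacts [Integrable.add hG.1 hH.1, hG.2.add hH.2, Integrable.add hG.3 hH.3]

lemma contourInt_add {r η : ℝ} {G H : ℂ → E} (hG : ContourIntegrable r η G)
    (hH : ContourIntegrable r η H) :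
    contourInt r η (fun z => G z + H z) = contourInt r η G + contourInt r η H := by
  simp only [contourInt, rayInt, arcInt, smul_add]
  rw [integral_add hG.1 hH.1, intervalIntegral.integral_add hG.2 hH.2, integral_add hG.3 hH.3]
  abel

lemma ContourIntegrable.clm {F : Type*} [NormedAddCommGroup F] [NormedSpace ℂ F] {r η : ℝ}
    {G : ℂ → E} (hG : ContourIntegrable r η G) (L : E →L[ℂ] F) :
    ContourIntegrable r η fun z => L (G z) := by
  refine ⟨?_, ?_, ?_⟩ <;> simp only [← map_smul]
  · exact L.integrable_comp hG.1
  · exact ⟨L.integrable_comp hG.2.1, L.integrable_comp hG.2.2⟩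
  · exact L.integrable_comp hG.3

lemma contourInt_clm {F : Type*} [NormedAddCommGroup F] [NormedSpace ℂ F] [CompleteSpace E]
    [CompleteSpace F] {r η : ℝ} {G : ℂ → E} (hG : ContourIntegrable r η G) (L : E →L[ℂ] F) :
    contourInt r η (fun z => L (G z)) = L (contourInt r η G) := by
  simp only [contourInt, rayInt, arcInt, ← map_smul, map_add, map_neg]
  rw [L.integral_comp_comm hG.1, L.intervalIntegral_comp_comm hG.2, L.integral_comp_comm hG.3]

lemma contourInt_congr {θ r η : ℝ} (hθ : θ < Real.pi) (hη : 0 < η) (hηθ : η < θ) (hr : 0 < r)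
    {G H : ℂ → E} (h : ∀ z ∈ csector θ, G z = H z) : contourInt r η G = contourInt r η H := by
  have hη' : |η| < θ := by rwa [abs_of_pos hη]
  have hray (ψ : ℝ) (hψ : |ψ| < θ) : rayInt r ψ G = rayInt r ψ H := by
    refine setIntegral_congr_fun measurableSet_Ioi fun ρ hρ => ?_
    simp only [h _ (mul_cis_mem_csector hθ (hr.trans hρ) hψ)]
  have harc : arcInt r η G = arcInt r η H := by
    refine intervalIntegral.integral_congr fun φ hφ => ?_
    rw [uIcc_of_le (by linarith)] at hφ
    simp only [h _ (mul_cis_mem_csector hθ hr ((abs_le.2 hφ).trans_lt hηθ))]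
  rw [contourInt, contourInt, hray η hη', hray (-η) (by rwa [abs_neg]), harc]

lemma contourAdmissible_const {θ : ℝ} (c : E) : ContourAdmissible θ fun _ => c :=
  ⟨by fun_prop, fun _ _ => ⟨‖c‖, fun _ _ _ => le_rfl⟩⟩

lemma contourAdmissible_inv {θ : ℝ} : ContourAdmissible θ fun z : ℂ => z⁻¹ := by
  refine ⟨fun z hz => (differentiableAt_inv hz.1).differentiableWithinAt, fun r hr => ⟨r⁻¹, ?_⟩⟩
  intro z _ hrz
  rw [norm_inv]
  exact inv_anti₀ hr hrz

/-- The mean value property of `z ↦ e^{az}` over the circle, in angular form. -/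
lemma integral_exp_mul_cis (a : ℂ) :
    ∫ φ in (-Real.pi)..Real.pi, Complex.exp (a * cis φ) = 2 * Real.pi := by
  have hper : Function.Periodic (fun φ : ℝ => Complex.exp (a * cis φ)) (2 * Real.pi) := by
    intro φ
    simp only [cis]
    push_cast
    rw [add_mul, Complex.exp_periodic (φ * Complex.I)]
  have h1 := hper.intervalIntegral_add_eq (-Real.pi) 0
  rw [show -Real.pi + 2 * Real.pi = Real.pi by ring, zero_add] at h1
  rw [h1]
  have h2 := Complex.circleIntegral_sub_center_inv_smul_of_differentiable_on_off_countable
    (R := 1) one_pos (f := fun z => Complex.exp (a * z)) (c := 0) countable_empty (by fun_prop)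
    (fun z _ => by fun_prop)
  have h3 : (∮ z in C(0, 1), (z - 0)⁻¹ • Complex.exp (a * z)) =
      Complex.I * ∫ φ in (0 : ℝ)..2 * Real.pi, Complex.exp (a * cis φ) := by
    rw [circleIntegral, ← intervalIntegral.integral_const_mul]
    refine intervalIntegral.integral_congr fun φ _ => ?_
    have := cis_ne_zero φ
    simp only [cis] at this
    simp [circleMap, cis]
    field_simp
  rw [h3] at h2
  simp only [mul_zero, Complex.exp_zero, smul_eq_mul, mul_one] at h2
  exact mul_left_cancel₀ Complex.I_ne_zero (h2.trans (by ring))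

/-- The rotation of a ray: the derivative of `∫_{ray} e^{tz} z⁻¹ dz` with respect to the angle is
the contribution of the end point. -/
lemma hasDerivAt_rayInt_exp_inv {r t ψ : ℝ} (hr : 0 < r) (ht : 0 < t) (hc : Real.cos ψ < 0) :
    HasDerivAt (fun ψ => rayInt r ψ fun z => Complex.exp (t * z) • z⁻¹)
      (-(Complex.I * Complex.exp (t * r * cis ψ))) ψ := by
  have hform (x : ℝ) : (rayInt r x fun z => Complex.exp (t * z) • z⁻¹) =
      ∫ ρ in Ioi r, Complex.exp (t * (ρ * cis x)) * (ρ : ℂ)⁻¹ := by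
    refine integral_congr_ae (.of_forall fun ρ => ?_)
    have := cis_ne_zero x
    simp only [smul_eq_mul, mul_inv]
    field_simp
  simp only [hform]
  have hneg : t * (Real.cos ψ / 2) < 0 := mul_neg_of_pos_of_neg ht (by linarith)
  have hneg' : t * Real.cos ψ < 0 := mul_neg_of_pos_of_neg ht hc
  have hcts : ContinuousOn (fun ρ : ℝ => (ρ : ℂ)⁻¹) (Ioi r) :=
    ContinuousOn.inv₀ (by fun_prop) fun ρ hρ => by
      exact_mod_cast (hr.trans hρ).ne'
  have hmeas (x : ℝ) : AEStronglyMeasurable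
      (fun ρ : ℝ => Complex.exp (t * (ρ * cis x)) * (ρ : ℂ)⁻¹) (volume.restrict (Ioi r)) :=
    ContinuousOn.aestronglyMeasurable (ContinuousOn.mul (by fun_prop) hcts) measurableSet_Ioi
  have hmain := (hasDerivAt_integral_of_dominated_loc_of_deriv_le (μ := volume.restrict (Ioi r))
    (s := {x : ℝ | Real.cos x < Real.cos ψ / 2}) (x₀ := ψ)
    (F := fun (x ρ : ℝ) => Complex.exp (t * (ρ * cis x)) * (ρ : ℂ)⁻¹)
    (F' := fun (x ρ : ℝ) => t * (cis x * Complex.I) * Complex.exp (t * (ρ * cis x)))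
    (bound := fun ρ => t * Real.exp (t * (Real.cos ψ / 2) * ρ))
    ((isOpen_lt Real.continuous_cos continuous_const).mem_nhds
      (show Real.cos ψ < Real.cos ψ / 2 by linarith))
    (.of_forall hmeas) ?_ ?_ ?_ ((integrableOn_exp_mul_Ioi hneg r).const_mul t) ?_).2
  · refine hmain.congr_deriv ?_
    have hre : ((t : ℂ) * cis ψ).re < 0 := by rwa [Complex.re_ofReal_mul, cis_re]
    have h1 := integral_exp_mul_complex_Ioi hre r
    have h2 : ∀ ρ : ℝ, (t : ℂ) * (cis ψ * Complex.I) * Complex.exp (t * (ρ * cis ψ)) =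
        t * (cis ψ * Complex.I) * Complex.exp (t * cis ψ * ρ) := fun ρ => by ring_nf
    rw [integral_congr_ae (.of_forall h2), integral_const_mul, h1]
    have := cis_ne_zero ψ
    have ht' : (t : ℂ) ≠ 0 := by exact_mod_cast ht.ne'
    field_simp
  · refine Integrable.mono' ((integrableOn_exp_mul_Ioi hneg' r).mul_const r⁻¹) (hmeas ψ) ?_
    filter_upwards [ae_restrict_mem measurableSet_Ioi] with ρ hρ
    have hρ' : r < ρ := hρ
    rw [norm_mul, norm_exp_mul_mul_cis, norm_inv, Complex.norm_real,
      Real.norm_of_nonneg (hr.trans hρ').le]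
    exact mul_le_mul_of_nonneg_left (inv_anti₀ hr hρ'.le) (Real.exp_pos _).le
  · exact Continuous.aestronglyMeasurable (by fun_prop)
  · filter_upwards [ae_restrict_mem measurableSet_Ioi] with ρ hρ x hx
    have hρ0 : 0 < ρ := hr.trans hρ
    have hx' : Real.cos x < Real.cos ψ / 2 := hx
    rw [norm_mul, norm_exp_mul_mul_cis, norm_mul, norm_mul, norm_cis, Complex.norm_I, mul_one,
      mul_one, Complex.norm_real, Real.norm_of_nonneg ht.le]
    gcongr
  · filter_upwards [ae_restrict_mem measurableSet_Ioi] with ρ hρ x _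
    have hρ0 : (ρ : ℂ) ≠ 0 := by exact_mod_cast (hr.trans hρ).ne'
    have h := ((((hasDerivAt_cis x).const_mul (ρ : ℂ)).const_mul (t : ℂ)).cexp).mul_const (ρ : ℂ)⁻¹
    refine h.congr_deriv ?_
    field_simp

/-- Hankel's integral `∫_γ e^{tz} z⁻¹ dz = 2πi`: the value does not depend on the angle, and at
the angle `π` the two rays cancel. -/
lemma contourInt_exp_inv {r t η : ℝ} (hr : 0 < r) (ht : 0 < t) (hη : Real.pi / 2 < η)
    (hη' : η < Real.pi) :
    (contourInt r η fun z => Complex.exp (t * z) • z⁻¹) = 2 * Real.pi * Complex.I := by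
  have hr' : (r : ℂ) ≠ 0 := by exact_mod_cast hr.ne'
  have harc (x : ℝ) : (arcInt r x fun z => Complex.exp (t * z) • z⁻¹) =
      Complex.I * ∫ φ in (-x)..x, Complex.exp (t * r * cis φ) := by
    rw [arcInt, ← intervalIntegral.integral_const_mul]
    refine intervalIntegral.integral_congr fun φ _ => ?_
    have := cis_ne_zero φ
    simp only [smul_eq_mul, mul_assoc]
    field_simp
  have hcont : Continuous fun φ : ℝ => Complex.exp (t * r * cis φ) := by
    have := continuous_cis
    fun_prop
  have hder : ∀ x ∈ Ioo (Real.pi / 2) (Real.pi + Real.pi / 2),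
      HasDerivAt (fun x => contourInt r x fun z => Complex.exp (t * z) • z⁻¹) 0 x := by
    intro x hx
    have hcx : Real.cos x < 0 := Real.cos_neg_of_pi_div_two_lt_of_lt hx.1 hx.2
    have h1 := hasDerivAt_rayInt_exp_inv hr ht hcx
    have h2 := (hasDerivAt_rayInt_exp_inv (ψ := -x) hr ht
      (by rwa [Real.cos_neg])).scomp x (hasDerivAt_neg x)
    have h3 : HasDerivAt (fun x : ℝ => Complex.I * ∫ φ in (-x)..x, Complex.exp (t * r * cis φ))
        (Complex.I * (Complex.exp (t * r * cis x) + Complex.exp (t * r * cis (-x)))) x := by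
      refine HasDerivAt.const_mul Complex.I ?_
      have hsplit (y : ℝ) : ∫ φ in (-y)..y, Complex.exp (t * r * cis φ) =
          (∫ φ in (0 : ℝ)..y, Complex.exp (t * r * cis φ)) -
            ∫ φ in (0 : ℝ)..(-y), Complex.exp (t * r * cis φ) :=
        (intervalIntegral.integral_interval_sub_left (hcont.intervalIntegrable _ _)
          (hcont.intervalIntegrable _ _)).symm
      simp only [hsplit]
      have h4 := hcont.integral_hasStrictDerivAt 0 x
      have h5 := ((hcont.integral_hasStrictDerivAt 0 (-x)).hasDerivAt).scomp x (hasDerivAt_neg x)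
      refine (h4.hasDerivAt.sub h5).congr_deriv ?_
      rw [neg_one_smul, sub_neg_eq_add]
    refine (((h2.neg.add h3).add h1).congr_of_eventuallyEq (.of_forall fun y => ?_)).congr_deriv ?_
    · simp only [contourInt, harc]
      rfl
    · rw [neg_one_smul]
      ring
  have hconst := isOpen_Ioo.is_const_of_deriv_eq_zero isPreconnected_Ioo
    (fun x hx => (hder x hx).differentiableAt.differentiableWithinAt)
    (fun x hx => (hder x hx).deriv) (x := η) (y := Real.pi)
    ⟨hη, by linarith [Real.pi_pos]⟩ ⟨by linarith [Real.pi_pos], by linarith [Real.pi_pos]⟩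
  rw [hconst, contourInt, harc, integral_exp_mul_cis]
  have hcis : cis (-Real.pi) = cis Real.pi := by
    simp [cis, Complex.exp_neg]
  rw [rayInt, rayInt, hcis]
  ring

lemma contourInt_exp [CompleteSpace E] {r t η : ℝ} (hr : 0 < r) (ht : 0 < t)
    (hη : Real.pi / 2 < η) (hη' : η < Real.pi) (c : E) :
    (contourInt r η fun z => Complex.exp (t * z) • c) = 0 := by
  obtain ⟨θ, hηθ, hθ⟩ := exists_between hη'
  have hη0 : 0 < η := by linarith [Real.pi_pos]
  have hc : Real.cos η < 0 := Real.cos_neg_of_pi_div_two_lt_of_lt hη (by linarith [Real.pi_pos])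
  -- The integral of `e^{tz}` is the derivative in `t` of the constant Hankel integral.
  have h1 := hasDerivAt_contourInt hθ hη0 hηθ hc contourAdmissible_inv hr ht
  have h2 : HasDerivAt (fun t : ℝ => contourInt r η fun z => Complex.exp (t * z) • z⁻¹) 0 t := by
    refine (hasDerivAt_const t (2 * Real.pi * Complex.I)).congr_of_eventuallyEq ?_
    filter_upwards [Ioi_mem_nhds ht] with x hx using contourInt_exp_inv hr hx hη hη'
  have h3 : (contourInt r η fun z => Complex.exp (t * z) • (1 : ℂ)) = 0 := by
    rw [← h1.unique h2]
    refine contourInt_congr hθ hη0 hηθ hr fun z hz => ?_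
    rw [smul_eq_mul z, mul_inv_cancel₀ hz.1]
  have h4 := contourInt_clm ((contourAdmissible_const (1 : ℂ)).contourIntegrable hθ hη0 hηθ hc
    hr ht) ((ContinuousLinearMap.id ℂ ℂ).smulRight c)
  rw [h3, map_zero] at h4
  rw [← h4]
  simp

end ContourCalculus

/-! ### The semigroup of a sectorial pseudo-resolvent in a Banach algebra -/

section PseudoResolvent

variable {𝔸 : Type*} [NormedRing 𝔸] [NormedAlgebra ℂ 𝔸]

/-- `F` satisfies the resolvent identity on the sector of half-angle `θ > π/2` with vertex `0`, and
`‖F z‖ ≤ M / |z|` there. For the resolvent of a sectorial operator this is the only information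
that the construction of the semigroup uses. -/
structure IsSectorialFamily (θ M : ℝ) (F : ℂ → 𝔸) : Prop where
  gt : Real.pi / 2 < θ
  lt : θ < Real.pi
  resolvent : ∀ z ∈ csector θ, ∀ w ∈ csector θ, F z - F w = (w - z) • (F z * F w)
  bound : ∀ z ∈ csector θ, ‖F z‖ ≤ M / ‖z‖

/-- The Dunford integral `(2πi)⁻¹ ∫_γ e^{tz} F(z) dz`. -/
def dunfordSg (η : ℝ) (F : ℂ → 𝔸) (t : ℝ) : 𝔸 :=
  (2 * (Real.pi : ℂ) * Complex.I)⁻¹ • contourInt 1 η fun z => Complex.exp (t * z) • F z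

/-- The derivative `(2πi)⁻¹ ∫_γ e^{tz} z F(z) dz` of `dunfordSg`. -/
def dunfordSgDeriv (η : ℝ) (F : ℂ → 𝔸) (t : ℝ) : 𝔸 :=
  (2 * (Real.pi : ℂ) * Complex.I)⁻¹ • contourInt 1 η fun z => Complex.exp (t * z) • (z • F z)

namespace IsSectorialFamily

variable {θ M η : ℝ} {F : ℂ → 𝔸} (hF : IsSectorialFamily θ M F)
include hF

lemma one_mem : (1 : ℂ) ∈ csector θ :=
  ⟨one_ne_zero, by simpa using (by linarith [Real.pi_pos, hF.gt] : 0 < θ)⟩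

lemma M_nonneg : 0 ≤ M := by
  have := (norm_nonneg _).trans (hF.bound 1 hF.one_mem)
  simpa using this

lemma commute {z w : ℂ} (hz : z ∈ csector θ) (hw : w ∈ csector θ) : F z * F w = F w * F z := by
  by_cases h : z = w
  · rw [h]
  have h1 := hF.resolvent z hz w hw
  have h2 := hF.resolvent w hw z hz
  have h3 : (w - z) • (F z * F w) = (w - z) • (F w * F z) := by
    rw [← h1, ← neg_sub, h2, ← neg_smul, neg_sub]
  exact smul_right_injective 𝔸 (sub_ne_zero.2 (Ne.symm h)) h3

lemma mul_bound {z : ℂ} (hz : z ∈ csector θ) : ‖z • F z‖ ≤ M := by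
  rw [norm_smul]
  have hz0 : 0 < ‖z‖ := norm_pos_iff.2 hz.1
  calc ‖z‖ * ‖F z‖ ≤ ‖z‖ * (M / ‖z‖) := mul_le_mul_of_nonneg_left (hF.bound z hz) hz0.le
    _ = M := mul_div_cancel₀ _ hz0.ne'

lemma inv_bound {z : ℂ} {r : ℝ} (hr : 0 < r) (hz : z ∈ csector θ) (hrz : r ≤ ‖z‖) :
    ‖F z‖ ≤ M / r :=
  (hF.bound z hz).trans (div_le_div_of_nonneg_left hF.M_nonneg hr hrz)

lemma differentiableOn : DifferentiableOn ℂ F (csector θ) := by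
  intro z hz
  refine DifferentiableAt.differentiableWithinAt ?_
  have hnhds := (isOpen_csector hF.lt).mem_nhds hz
  have hz0 : 0 < ‖z‖ := norm_pos_iff.2 hz.1
  have hcont : ContinuousAt F z := by
    rw [ContinuousAt, tendsto_iff_norm_sub_tendsto_zero]
    have hlim : Filter.Tendsto (fun w : ℂ => ‖z - w‖ * (M / ‖w‖ * (M / ‖z‖)))
        (nhds z) (nhds 0) := by
      have h : ContinuousAt (fun w : ℂ => ‖z - w‖ * (M / ‖w‖ * (M / ‖z‖))) z := by
        refine ContinuousAt.mul (by fun_prop) (ContinuousAt.mul ?_ continuousAt_const)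
        exact continuousAt_const.div (by fun_prop) hz0.ne'
      simpa [ContinuousAt] using h
    refine squeeze_zero' (.of_forall fun _ => norm_nonneg _) ?_ hlim
    filter_upwards [hnhds] with w hw
    rw [hF.resolvent w hw z hz, norm_smul]
    refine mul_le_mul_of_nonneg_left ((norm_mul_le _ _).trans ?_) (norm_nonneg _)
    exact mul_le_mul (hF.bound w hw) (hF.bound z hz) (norm_nonneg _)
      (div_nonneg hF.M_nonneg (norm_nonneg _))
  have hder : HasDerivAt F (-(F z * F z)) z := by
    rw [hasDerivAt_iff_tendsto_slope]
    have hlim : Filter.Tendsto (fun w => -(F w * F z)) (nhdsWithin z {z}ᶜ)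
        (nhds (-(F z * F z))) :=
      ((hcont.mul continuousAt_const).neg.tendsto).mono_left nhdsWithin_le_nhds
    refine hlim.congr' ?_
    filter_upwards [mem_nhdsWithin_of_mem_nhds hnhds, self_mem_nhdsWithin] with w hw hwz
    have : w - z ≠ 0 := sub_ne_zero.2 hwz
    rw [slope_def_module, hF.resolvent w hw z hz, smul_smul, ← neg_sub w z, mul_neg,
      inv_mul_cancel₀ this, neg_one_smul]
  exact hder.differentiableAt

lemma admissible : ContourAdmissible θ F :=
  ⟨hF.differentiableOn, fun r hr => ⟨M / r, fun _ hz hrz => hF.inv_bound hr hz hrz⟩⟩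

lemma admissible_mul : ContourAdmissible θ fun z => z • F z :=
  ⟨differentiableOn_id.smul hF.differentiableOn, fun _ _ => ⟨M, fun _ hz _ => hF.mul_bound hz⟩⟩

lemma admissible_inv : ContourAdmissible θ fun z => z⁻¹ • F z := by
  refine ⟨contourAdmissible_inv.diff.smul hF.differentiableOn,
    fun r hr => ⟨r⁻¹ * (M / r), fun z hz hrz => ?_⟩⟩
  rw [norm_smul, norm_inv]
  exact mul_le_mul (inv_anti₀ hr hrz) (hF.inv_bound hr hz hrz) (norm_nonneg _) (by positivity)

section Angle

variable (hη : Real.pi / 2 < η) (hηθ : η < θ)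
include hη hηθ

omit hηθ hF in
lemma eta_pos : 0 < η := by linarith [Real.pi_pos]

lemma cos_eta_neg : Real.cos η < 0 :=
  Real.cos_neg_of_pi_div_two_lt_of_lt hη (by linarith [hF.lt, Real.pi_pos])

variable [CompleteSpace 𝔸]

/-- Contour integrals with an admissible weight may be taken over the contour of radius `1/t`. -/
lemma contourInt_radius {P : ℂ → 𝔸} (hP : ContourAdmissible θ P) {t : ℝ} (ht : 0 < t) :
    (contourInt 1 η fun z => Complex.exp (t * z) • P z) =
      contourInt (1 / t) η fun z => Complex.exp (t * z) • P z := by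
  have hc := hF.cos_eta_neg hη hηθ
  have hexp : DifferentiableOn ℂ (fun z : ℂ => Complex.exp (t * z)) (csector θ) := by fun_prop
  refine contourInt_eq_of_radius hF.lt (eta_pos hη) hηθ
    (hexp.smul hP.diff) (fun ψ hψ r hr => ?_) one_pos (one_div_pos.2 ht)
  refine integrableOn_rayInt hF.lt hP hr (by rwa [hψ]) ?_ ht
  rwa [← Real.cos_abs, hψ]

/-- The bounds `E(t) = O(1)` and `E'(t) = O(1/t)`, and `O(t)` with the additional factor `z⁻¹`. -/
lemma exists_norm_le : ∃ K : ℝ, 0 ≤ K ∧ ∀ t > 0,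
    ‖dunfordSg η F t‖ ≤ K ∧ ‖dunfordSgDeriv η F t‖ ≤ K / t ∧
    ‖(2 * (Real.pi : ℂ) * Complex.I)⁻¹ • contourInt 1 η
      fun z => Complex.exp (t * z) • (z⁻¹ • F z)‖ ≤ K * t := by
  obtain ⟨C, hC, hbd⟩ := exists_norm_contourInt_le (E := 𝔸) (eta_pos hη) (hF.cos_eta_neg hη hηθ)
  refine ⟨‖(2 * (Real.pi : ℂ) * Complex.I)⁻¹‖ * (C * M),
    mul_nonneg (norm_nonneg _) (mul_nonneg hC hF.M_nonneg), fun t ht => ?_⟩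
  have hr : 0 < 1 / t := by positivity
  have hmem : ∀ ρ ψ : ℝ, 1 / t ≤ ρ → |ψ| ≤ η → (ρ : ℂ) * cis ψ ∈ csector θ ∧
      1 / t ≤ ‖(ρ : ℂ) * cis ψ‖ := fun ρ ψ hρ hψ =>
    ⟨mul_cis_mem_csector hF.lt (hr.trans_le hρ) (hψ.trans_lt hηθ), by
      rwa [norm_mul_cis (hr.trans_le hρ).le]⟩
  have hM := hF.M_nonneg
  refine ⟨?_, ?_, ?_⟩
  · rw [dunfordSg, norm_smul, hF.contourInt_radius hη hηθ hF.admissible ht]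
    refine mul_le_mul_of_nonneg_left ((hbd _ t (M / (1 / t)) ht fun ρ ψ hρ hψ =>
      hF.inv_bound hr (hmem ρ ψ hρ hψ).1 (hmem ρ ψ hρ hψ).2).trans (le_of_eq ?_)) (norm_nonneg _)
    field_simp
  · rw [dunfordSgDeriv, norm_smul, hF.contourInt_radius hη hηθ hF.admissible_mul ht, mul_div_assoc]
    refine mul_le_mul_of_nonneg_left ((hbd _ t M ht fun ρ ψ hρ hψ =>
      hF.mul_bound (hmem ρ ψ hρ hψ).1).trans (le_of_eq ?_)) (norm_nonneg _)
    ring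
  · rw [norm_smul, hF.contourInt_radius hη hηθ hF.admissible_inv ht]
    have hP : ∀ ρ ψ : ℝ, 1 / t ≤ ρ → |ψ| ≤ η →
        ‖((ρ : ℂ) * cis ψ)⁻¹ • F (ρ * cis ψ)‖ ≤ M * t * t := by
      intro ρ ψ hρ hψ
      obtain ⟨h1, h2⟩ := hmem ρ ψ hρ hψ
      rw [norm_smul, norm_inv]
      calc ‖(ρ : ℂ) * cis ψ‖⁻¹ * ‖F (ρ * cis ψ)‖ ≤ (1 / t)⁻¹ * (M / (1 / t)) :=
            mul_le_mul (inv_anti₀ hr h2) (hF.inv_bound hr h1 h2) (norm_nonneg _) (by positivity)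
        _ = M * t * t := by field_simp
    refine (mul_le_mul_of_nonneg_left (hbd (fun z => z⁻¹ • F z) t (M * t * t) ht hP)
      (norm_nonneg _)).trans (le_of_eq ?_)
    field_simp

lemma hasDerivAt_dunfordSg {t : ℝ} (ht : 0 < t) :
    HasDerivAt (dunfordSg η F) (dunfordSgDeriv η F t) t :=
  (hasDerivAt_contourInt hF.lt (eta_pos hη) hηθ (hF.cos_eta_neg hη hηθ) hF.admissible one_pos
    ht).const_smul ((2 * (Real.pi : ℂ) * Complex.I)⁻¹)

lemma continuousAt_dunfordSgDeriv {t : ℝ} (ht : 0 < t) : ContinuousAt (dunfordSgDeriv η F) t :=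
  ((hasDerivAt_contourInt hF.lt (eta_pos hη) hηθ (hF.cos_eta_neg hη hηθ) hF.admissible_mul one_pos
    ht).const_smul ((2 * (Real.pi : ℂ) * Complex.I)⁻¹)).continuousAt

/-- `E(t) = F(1) (E(t) - E'(t))`: the values of the semigroup lie in the domain of the generator. -/
lemma dunfordSg_eq {t : ℝ} (ht : 0 < t) :
    dunfordSg η F t = F 1 * (dunfordSg η F t - dunfordSgDeriv η F t) := by
  have h0 := eta_pos hη
  have hc := hF.cos_eta_neg hη hηθ
  have hint {P : ℂ → 𝔸} (hP : ContourAdmissible θ P) :=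
    hP.contourIntegrable hF.lt h0 hηθ hc one_pos ht
  have h1 := contourInt_clm (hint hF.admissible) (ContinuousLinearMap.mul ℂ 𝔸 (F 1))
  have h2 := contourInt_clm (hint hF.admissible_mul) (-ContinuousLinearMap.mul ℂ 𝔸 (F 1))
  have h3 := contourInt_exp one_pos ht hη (hηθ.trans hF.lt) (F 1)
  have h12 := contourInt_add ((hint hF.admissible).clm (ContinuousLinearMap.mul ℂ 𝔸 (F 1)))
    ((hint hF.admissible_mul).clm (-ContinuousLinearMap.mul ℂ 𝔸 (F 1)))
  have h123 := contourInt_add (hint (contourAdmissible_const (F 1)))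
    (((hint hF.admissible).clm (ContinuousLinearMap.mul ℂ 𝔸 (F 1))).add
    ((hint hF.admissible_mul).clm (-ContinuousLinearMap.mul ℂ 𝔸 (F 1))))
  rw [h12, h1, h2, h3, zero_add] at h123
  have hcongr : (contourInt 1 η fun z => Complex.exp (t * z) • F z) = contourInt 1 η fun z =>
      Complex.exp (t * z) • F 1 + (ContinuousLinearMap.mul ℂ 𝔸 (F 1) (Complex.exp (t * z) • F z) +
        (-ContinuousLinearMap.mul ℂ 𝔸 (F 1)) (Complex.exp (t * z) • (z • F z))) := by
    refine contourInt_congr hF.lt h0 hηθ one_pos fun z hz => ?_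
    have h4 := hF.resolvent 1 hF.one_mem z hz
    have h5 : F z = F 1 + (F 1 * F z - z • (F 1 * F z)) := by
      rw [← one_smul ℂ (F 1 * F z), smul_smul, mul_one, ← sub_smul, ← neg_sub z 1, neg_smul, ← h4]
      abel
    simp only [neg_apply, ContinuousLinearMap.mul_apply', mul_smul_comm]
    conv_lhs => rw [h5]
    rw [smul_add, smul_sub, sub_eq_add_neg]
  rw [dunfordSg, dunfordSgDeriv, ← smul_sub, mul_smul_comm]
  refine congrArg _ (hcongr.trans (h123.trans ?_))
  rw [neg_apply, ContinuousLinearMap.mul_apply', ContinuousLinearMap.mul_apply', mul_sub,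
    sub_eq_add_neg]

/-- Whatever commutes with all `F z` commutes with a contour integral of `F`. -/
lemma commute_contourInt {P : ℂ → 𝔸} (hP : ContourAdmissible θ P) {a : 𝔸}
    (ha : ∀ z ∈ csector θ, a * P z = P z * a) {t : ℝ} (ht : 0 < t) :
    a * (contourInt 1 η fun z => Complex.exp (t * z) • P z) =
      (contourInt 1 η fun z => Complex.exp (t * z) • P z) * a := by
  have hint := hP.contourIntegrable hF.lt (eta_pos hη) hηθ (hF.cos_eta_neg hη hηθ) one_pos ht
  have h1 := contourInt_clm hint (ContinuousLinearMap.mul ℂ 𝔸 a)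
  have h2 := contourInt_clm hint ((ContinuousLinearMap.mul ℂ 𝔸).flip a)
  simp only [ContinuousLinearMap.mul_apply', ContinuousLinearMap.flip_apply] at h1 h2
  rw [← h1, ← h2]
  refine contourInt_congr hF.lt (eta_pos hη) hηθ one_pos fun z hz => ?_
  rw [mul_smul_comm, smul_mul_assoc, ha z hz]

lemma commute_dunfordSg {a : 𝔸} (ha : ∀ z ∈ csector θ, a * F z = F z * a) {t : ℝ} (ht : 0 < t) :
    a * dunfordSg η F t = dunfordSg η F t * a := by
  rw [dunfordSg, mul_smul_comm, smul_mul_assoc,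
    hF.commute_contourInt hη hηθ hF.admissible ha ht]

lemma commute_dunfordSgDeriv {a : 𝔸} (ha : ∀ z ∈ csector θ, a * F z = F z * a) {t : ℝ}
    (ht : 0 < t) : a * dunfordSgDeriv η F t = dunfordSgDeriv η F t * a := by
  rw [dunfordSgDeriv, mul_smul_comm, smul_mul_assoc,
    hF.commute_contourInt hη hηθ hF.admissible_mul (fun z hz => by
      rw [mul_smul_comm, smul_mul_assoc, ha z hz]) ht]

/-- `E(h) F(1) → F(1)` as `h → 0`: on the range of `F(1)` the semigroup is continuous at `0`. -/
lemma exists_norm_dunfordSg_mul_sub_le :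
    ∃ K : ℝ, 0 ≤ K ∧ ∀ h > 0, ‖dunfordSg η F h * F 1 - F 1‖ ≤ K * h := by
  obtain ⟨K, hK, hbd⟩ := hF.exists_norm_le hη hηθ
  refine ⟨K * ‖F 1 - 1‖, by positivity, fun h hh => ?_⟩
  have h0 := eta_pos hη
  have hc := hF.cos_eta_neg hη hηθ
  have hinv := (contourAdmissible_inv (θ := θ)).contourIntegrable hF.lt h0 hηθ hc one_pos hh
  have hFint := hF.admissible.contourIntegrable hF.lt h0 hηθ hc one_pos hh
  have hFinv := hF.admissible_inv.contourIntegrable hF.lt h0 hηθ hc one_pos hh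
  set L₁ := (ContinuousLinearMap.mul ℂ 𝔸).flip (F 1)
  set L₂ := (ContinuousLinearMap.mul ℂ 𝔸).flip (F 1 - 1)
  set L₃ := (ContinuousLinearMap.id ℂ ℂ).smulRight (F 1)
  have h1 := contourInt_clm hFint L₁
  have h2 := contourInt_clm hFinv L₂
  have h3 := contourInt_clm hinv L₃
  have h4 := contourInt_add (hinv.clm L₃) (hFinv.clm L₂)
  rw [contourInt_exp_inv one_pos hh hη (hηθ.trans hF.lt)] at h3
  -- The identity `F z F(1) = z⁻¹ F(1) + z⁻¹ F z (F(1) - 1)`, integrated over the contour.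
  have hcongr : (contourInt 1 η fun z => L₁ (Complex.exp (h * z) • F z)) = contourInt 1 η fun z =>
      L₃ (Complex.exp (h * z) • z⁻¹) + L₂ (Complex.exp (h * z) • (z⁻¹ • F z)) := by
    refine contourInt_congr hF.lt h0 hηθ one_pos fun z hz => ?_
    have h5 := hF.resolvent z hz 1 hF.one_mem
    have h6 : z • (F z * F 1) = F 1 + F z * (F 1 - 1) := by
      rw [sub_smul, one_smul] at h5
      rw [mul_sub, mul_one, ← sub_eq_zero]
      rw [← sub_eq_zero] at h5
      rw [← h5]
      abel
    have h7 : F z * F 1 = z⁻¹ • F 1 + z⁻¹ • (F z * (F 1 - 1)) := by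
      rw [← smul_add, ← h6, smul_smul, inv_mul_cancel₀ hz.1, one_smul]
    simp only [L₁, L₂, L₃, ContinuousLinearMap.flip_apply, ContinuousLinearMap.mul_apply',
      ContinuousLinearMap.smulRight_apply, ContinuousLinearMap.id_apply, smul_mul_assoc, h7,
      smul_add, smul_assoc]
  rw [hcongr, h4, h2, h3] at h1
  have hpi : (2 * (Real.pi : ℂ) * Complex.I) ≠ 0 := by
    simp [Real.pi_ne_zero]
  have h8 : dunfordSg η F h * F 1 - F 1 = ((2 * (Real.pi : ℂ) * Complex.I)⁻¹ • contourInt 1 η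
      fun z => Complex.exp (h * z) • (z⁻¹ • F z)) * (F 1 - 1) := by
    have h9 : dunfordSg η F h * F 1 = (2 * (Real.pi : ℂ) * Complex.I)⁻¹ •
        L₁ (contourInt 1 η fun z => Complex.exp (h * z) • F z) := by
      simp only [dunfordSg, L₁, smul_mul_assoc, ContinuousLinearMap.flip_apply,
        ContinuousLinearMap.mul_apply']
    rw [h9, ← h1]
    simp only [L₂, L₃, ContinuousLinearMap.flip_apply, ContinuousLinearMap.mul_apply',
      ContinuousLinearMap.smulRight_apply, ContinuousLinearMap.id_apply, smul_add, smul_smul,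
      inv_mul_cancel₀ hpi, one_smul, smul_mul_assoc]
    abel
  rw [h8]
  refine (norm_mul_le _ _).trans ?_
  calc _ ≤ K * h * ‖F 1 - 1‖ := mul_le_mul_of_nonneg_right (hbd h hh).2.2 (norm_nonneg _)
    _ = _ := by ring

/-- The semigroup law: `σ ↦ E(t - σ) E(s + σ)` has derivative zero, and tends to `E(s + t)` as
`σ → t`. -/
lemma dunfordSg_add {s t : ℝ} (hs : 0 < s) (ht : 0 < t) :
    dunfordSg η F (s + t) = dunfordSg η F s * dunfordSg η F t := by
  set S := dunfordSg η F with hS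
  set D := dunfordSgDeriv η F with hD
  have hcommF1S {a : ℝ} (ha : 0 < a) : F 1 * S a = S a * F 1 :=
    hF.commute_dunfordSg hη hηθ (fun z hz => hF.commute hF.one_mem hz) ha
  have hcommF1D {a : ℝ} (ha : 0 < a) : F 1 * D a = D a * F 1 :=
    hF.commute_dunfordSgDeriv hη hηθ (fun z hz => hF.commute hF.one_mem hz) ha
  have hcommS {a b : ℝ} (ha : 0 < a) (hb : 0 < b) : S a * S b = S b * S a :=
    hF.commute_dunfordSg hη hηθ (fun z hz => (hF.commute_dunfordSg hη hηθ
      (fun w hw => hF.commute hz hw) ha).symm) hb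
  have hDS {a b : ℝ} (ha : 0 < a) (hb : 0 < b) : D a * S b = S a * D b := by
    have h1 : D a * S b = S a * S b - (S a - D a) * S b := by rw [sub_mul, sub_sub_cancel]
    have h2 : S a * D b = S a * S b - S a * (S b - D b) := by rw [mul_sub, sub_sub_cancel]
    have h3 : (S a - D a) * S b = S a * (S b - D b) := by
      conv_lhs => rw [hS, hF.dunfordSg_eq hη hηθ hb, ← hS, ← hD, ← mul_assoc, sub_mul,
        ← hcommF1S ha, ← hcommF1D ha, ← mul_sub]
      conv_rhs => rw [hS, hF.dunfordSg_eq hη hηθ ha, ← hS, ← hD]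
    rw [h1, h2, h3]
  have hder : ∀ σ ∈ Ioo (-s) t, HasDerivAt (fun σ => S (t - σ) * S (s + σ)) 0 σ := by
    intro σ hσ
    have ha : 0 < t - σ := by linarith [hσ.2]
    have hb : 0 < s + σ := by linarith [hσ.1]
    have h1 : HasDerivAt (fun σ => S (t - σ)) (-D (t - σ)) σ :=
      HasDerivAt.comp_const_sub t σ (hF.hasDerivAt_dunfordSg hη hηθ ha)
    have h2 : HasDerivAt (fun σ => S (s + σ)) (D (s + σ)) σ :=
      HasDerivAt.comp_const_add s σ (hF.hasDerivAt_dunfordSg hη hηθ hb)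
    refine (h1.mul h2).congr_deriv ?_
    rw [neg_mul, hDS ha hb, neg_add_cancel]
  have hconst : ∀ σ ∈ Ioo (-s) t, S (t - σ) * S (s + σ) = S t * S s := by
    intro σ hσ
    have := isOpen_Ioo.is_const_of_deriv_eq_zero isPreconnected_Ioo
      (fun x hx => (hder x hx).differentiableAt.differentiableWithinAt)
      (fun x hx => (hder x hx).deriv) hσ (show (0 : ℝ) ∈ Ioo (-s) t from ⟨by linarith, ht⟩)
    simpa using this
  have hst : 0 < s + t := by linarith
  obtain ⟨K, hK, hKb⟩ := hF.exists_norm_dunfordSg_mul_sub_le hη hηθ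
  have hlim1 : Filter.Tendsto (fun σ => S (t - σ) * F 1) (nhdsWithin t (Iio t))
      (nhds (F 1)) := by
    rw [tendsto_iff_norm_sub_tendsto_zero]
    have h0 : Filter.Tendsto (fun σ => K * (t - σ)) (nhdsWithin t (Iio t)) (nhds 0) := by
      have : Continuous fun σ => K * (t - σ) := by fun_prop
      have h := this.tendsto t
      rw [sub_self, mul_zero] at h
      exact h.mono_left nhdsWithin_le_nhds
    refine squeeze_zero' (.of_forall fun _ => norm_nonneg _) ?_ h0
    filter_upwards [self_mem_nhdsWithin] with σ hσ using hKb _ (sub_pos.2 hσ)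
  have hlim2 : Filter.Tendsto (fun σ => S (s + σ) - D (s + σ)) (nhdsWithin t (Iio t))
      (nhds (S (s + t) - D (s + t))) := by
    have h1 : ContinuousAt (fun x => S x - D x) (s + t) :=
      (hF.hasDerivAt_dunfordSg hη hηθ hst).continuousAt.sub
        (hF.continuousAt_dunfordSgDeriv hη hηθ hst)
    have h2 : ContinuousAt (fun σ => S (s + σ) - D (s + σ)) t :=
      ContinuousAt.comp (f := fun σ => s + σ) (g := fun x => S x - D x) h1 (by fun_prop)
    exact h2.tendsto.mono_left nhdsWithin_le_nhds
  have hlim := hlim1.mul hlim2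
  rw [← hF.dunfordSg_eq hη hηθ hst] at hlim
  have hlim' : Filter.Tendsto (fun _ : ℝ => S t * S s) (nhdsWithin t (Iio t))
      (nhds (S (s + t))) := by
    refine hlim.congr' ?_
    filter_upwards [self_mem_nhdsWithin,
      mem_nhdsWithin_of_mem_nhds (Ioi_mem_nhds (show -s < t by linarith))] with σ h1 h2
    have hb : 0 < s + σ := by
      have : -s < σ := h2
      linarith
    rw [mul_assoc, hD, ← hF.dunfordSg_eq hη hηθ hb, ← hconst σ ⟨h2, h1⟩]
  rw [tendsto_nhds_unique hlim' tendsto_const_nhds, hcommS ht hs]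

lemma dunfordSgDeriv_add {s t : ℝ} (hs : 0 < s) (ht : 0 < t) :
    dunfordSgDeriv η F (s + t) = dunfordSgDeriv η F s * dunfordSg η F t := by
  have h1 : HasDerivAt (fun x => dunfordSg η F (x + t)) (dunfordSgDeriv η F (s + t)) s :=
    HasDerivAt.comp_add_const s t (hF.hasDerivAt_dunfordSg hη hηθ (add_pos hs ht))
  refine h1.unique (((hF.hasDerivAt_dunfordSg hη hηθ hs).mul_const _).congr_of_eventuallyEq ?_)
  filter_upwards [Ioi_mem_nhds hs] with x hx using hF.dunfordSg_add hη hηθ hx ht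

end Angle

end IsSectorialFamily

end PseudoResolvent

/-! ### The analytic semigroup generated by a sectorial operator -/

section SectorialOperator

variable {X : Type*} [NormedAddCommGroup X] [NormedSpace ℂ X]

/-- The properties of the analytic semigroup `e^{tA}` and of `D t = A e^{tA}` on which the error
analysis rests. -/
structure IsAnalyticSemigroup (A : X →ₗ.[ℂ] X) (D : ℝ → X →L[ℂ] X) : Prop where
  add : ∀ s t, 0 ≤ s → 0 ≤ t → semigroup A (s + t) = semigroup A s * semigroup A t
  bound : ∀ T, ∃ K, 0 ≤ K ∧ ∀ t ∈ Ioc 0 T, ‖semigroup A t‖ ≤ K ∧ ‖D t‖ ≤ K / t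
  cont : ContinuousOn (semigroup A) (Ioi 0)
  contD : ContinuousOn D (Ioi 0)
  apply : ∀ t > 0, ∀ x, opApply A (semigroup A t x) = D t x
  D_add : ∀ s > 0, ∀ t ≥ 0, D (s + t) = D s * semigroup A t

lemma semigroup_zero (A : X →ₗ.[ℂ] X) : semigroup A 0 = 1 := if_pos rfl

lemma isResolventAt_opResolvent {A : X →ₗ.[ℂ] X} {z : ℂ} (hz : z ∈ opResolventSet A) :
    IsResolventAt A z (opResolvent A z) := by
  have h : ∃ R : X →L[ℂ] X, IsResolventAt A z R := hz
  rw [opResolvent, dif_pos h]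
  exact h.choose_spec

/-- The resolvent identity. -/
lemma IsResolventAt.sub_eq {A : X →ₗ.[ℂ] X} {z w : ℂ} {R S : X →L[ℂ] X}
    (hR : IsResolventAt A z R) (hS : IsResolventAt A w S) : R - S = (w - z) • (R * S) := by
  ext x
  obtain ⟨hmem, hx⟩ := hS.1 x
  have h1 : R (z • S x - A ⟨S x, hmem⟩) = S x := hR.2 ⟨S x, hmem⟩
  have h2 : A ⟨S x, hmem⟩ = w • S x - x :=
    eq_sub_of_add_eq ((add_comm _ _).trans (sub_eq_iff_eq_add.1 hx).symm)
  rw [h2, map_sub, map_smul, map_sub, map_smul] at h1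
  simp only [sub_apply, smul_apply,
    mul_apply_eq_comp, sub_smul]
  conv_lhs => rw [← h1]
  abel

lemma add_mem_sector {ω θ : ℝ} {z : ℂ} (hz : z ∈ csector θ) : (ω : ℂ) + z ∈ sector ω θ := by
  refine ⟨fun h => hz.1 (by simpa using h), ?_⟩
  rw [add_sub_cancel_left]
  exact hz.2

lemma IsSectorialWith.isSectorialFamily {A : X →ₗ.[ℂ] X} {ω θ M : ℝ}
    (hA : IsSectorialWith A ω θ M) :
    IsSectorialFamily θ M fun z => opResolvent A (ω + z) where
  gt := hA.angle_gt
  lt := hA.angle_lt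
  resolvent z hz w hw := by
    rw [(isResolventAt_opResolvent (hA.subset (add_mem_sector hz))).sub_eq
      (isResolventAt_opResolvent (hA.subset (add_mem_sector hw))), add_sub_add_left_eq_sub]
  bound z hz := by
    have := hA.bound _ (add_mem_sector hz)
    rwa [add_sub_cancel_left] at this

lemma dunford_eq_smul_dunfordSg (A : X →ₗ.[ℂ] X) (ω η t : ℝ) :
    dunford A ω 1 η t =
      Complex.exp (t * ω) • dunfordSg η (fun z => opResolvent A (ω + z)) t := by
  rw [dunford, dunfordSg, smul_comm]
  congr 1
  simp only [contourInt, rayInt, arcInt, smul_add, smul_neg, cis, Complex.ofReal_neg, neg_mul]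
  rw [← integral_smul, ← integral_smul, ← intervalIntegral.integral_smul]
  simp only [smul_smul, mul_add, Complex.exp_add]
  simp only [mul_assoc, mul_comm, mul_left_comm]

lemma IsSectorial.exists_isAnalyticSemigroup [CompleteSpace X] {A : X →ₗ.[ℂ] X}
    (hA : IsSectorial A) : ∃ D : ℝ → X →L[ℂ] X, IsAnalyticSemigroup A D := by
  obtain ⟨M, hM⟩ := hA.choose_spec.choose_spec
  set ω := hA.choose
  set θ := hA.choose_spec.choose
  set η := (θ + Real.pi / 2) / 2 with hηdef
  have hη : Real.pi / 2 < η := by linarith [hM.angle_gt]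
  have hηθ : η < θ := by linarith [hM.angle_gt]
  set F : ℂ → X →L[ℂ] X := fun z => opResolvent A (ω + z)
  have hF : IsSectorialFamily θ M F := hM.isSectorialFamily
  have hsg (t : ℝ) (ht : 0 < t) :
      semigroup A t = Complex.exp (t * ω) • dunfordSg η F t := by
    rw [semigroup, if_neg ht.ne', dif_pos hA]
    exact dunford_eq_smul_dunfordSg A ω η t
  set D : ℝ → X →L[ℂ] X := fun t =>
    Complex.exp (t * ω) • ((ω : ℂ) • dunfordSg η F t + dunfordSgDeriv η F t) with hD
  have hexp_add (s t : ℝ) : Complex.exp (((s + t : ℝ) : ℂ) * ω) =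
      Complex.exp (s * ω) * Complex.exp (t * ω) := by
    rw [← Complex.exp_add]
    push_cast
    ring_nf
  have hadd (s t : ℝ) (hs : 0 < s) (ht : 0 < t) :
      semigroup A (s + t) = semigroup A s * semigroup A t := by
    rw [hsg _ (add_pos hs ht), hsg s hs, hsg t ht, hF.dunfordSg_add hη hηθ hs ht,
      smul_mul_smul_comm, hexp_add]
  have hcont : ContinuousOn (dunfordSg η F) (Ioi 0) := fun t ht =>
    (hF.hasDerivAt_dunfordSg hη hηθ ht).continuousAt.continuousWithinAt
  have hcontD : ContinuousOn (dunfordSgDeriv η F) (Ioi 0) := fun t ht =>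
    (hF.continuousAt_dunfordSgDeriv hη hηθ ht).continuousWithinAt
  have hcexp : ContinuousOn (fun t : ℝ => Complex.exp (t * ω)) (Ioi 0) := by fun_prop
  refine ⟨D, ⟨?_, ?_, ?_, ?_, ?_, ?_⟩⟩
  · intro s t hs ht
    rcases hs.eq_or_lt with rfl | hs
    · rw [zero_add, semigroup_zero, one_mul]
    rcases ht.eq_or_lt with rfl | ht
    · rw [add_zero, semigroup_zero, mul_one]
    exact hadd s t hs ht
  · intro T
    obtain ⟨K, hK, hbd⟩ := hF.exists_norm_le hη hηθ
    have hexp (t : ℝ) (ht : t ∈ Ioc 0 T) : ‖Complex.exp (t * ω)‖ ≤ Real.exp (T * |ω|) := by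
      rw [Complex.norm_exp, ← Complex.ofReal_mul, Complex.ofReal_re]
      refine Real.exp_le_exp.2 ((le_abs_self _).trans ?_)
      rw [abs_mul, abs_of_pos ht.1]
      exact mul_le_mul_of_nonneg_right ht.2 (abs_nonneg _)
    have he := Real.exp_pos (T * |ω|)
    refine ⟨Real.exp (T * |ω|) * (|ω| * K * |T| + K), by positivity, fun t ht => ⟨?_, ?_⟩⟩
    all_goals
      obtain ⟨h1, h2, -⟩ := hbd t ht.1
      have ht0 : 0 < t := ht.1
    · rw [hsg t ht.1, norm_smul]
      refine mul_le_mul (hexp t ht) (h1.trans ?_) (norm_nonneg _) he.le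
      have : 0 ≤ |ω| * K * |T| := by positivity
      linarith
    · rw [hD, norm_smul, mul_div_assoc]
      refine mul_le_mul (hexp t ht) ((norm_add_le _ _).trans ?_) (norm_nonneg _) he.le
      rw [norm_smul, add_div]
      refine add_le_add ?_ h2
      rw [le_div_iff₀ ht0, Complex.norm_real, Real.norm_eq_abs]
      have h3 : t ≤ |T| := ht.2.trans (le_abs_self T)
      gcongr
  · exact (hcexp.smul hcont).congr fun t ht => hsg t ht
  · exact hcexp.smul (((continuousOn_const (c := (ω : ℂ))).smul hcont).add hcontD)
  · intro t ht x
    -- `e^{tA} x = R(ω + 1) y` for an explicit `y`.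
    set y := dunfordSg η F t x - dunfordSgDeriv η F t x with hy
    have h1 : dunfordSg η F t x = F 1 y := by
      have := congrArg (fun L : X →L[ℂ] X => L x) (hF.dunfordSg_eq hη hηθ ht)
      simpa [hy] using this
    obtain ⟨hmem, hres⟩ :=
      (isResolventAt_opResolvent (hM.subset (add_mem_sector hF.one_mem))).1 y
    have h2 : semigroup A t x = Complex.exp (t * ω) • F 1 y := by
      rw [hsg t ht, smul_apply, h1]
    have hmem' : semigroup A t x ∈ A.domain := by
      rw [h2]
      exact A.domain.smul_mem _ hmem
    rw [opApply, dif_pos hmem']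
    have h3 : (⟨semigroup A t x, hmem'⟩ : A.domain) = Complex.exp (t * ω) • ⟨F 1 y, hmem⟩ :=
      Subtype.ext h2
    have h4 : A ⟨F 1 y, hmem⟩ = ((ω : ℂ) + 1) • F 1 y - y := by
      have h5 : ((ω : ℂ) + 1) • F 1 y - A ⟨F 1 y, hmem⟩ = y := hres
      exact eq_sub_of_add_eq ((add_comm _ _).trans (sub_eq_iff_eq_add.1 h5).symm)
    rw [h3, LinearPMap.map_smul, h4, ← h1, hy, hD]
    simp only [smul_apply, add_apply, add_smul, one_smul]
    congr 1
    abel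
  · intro s hs t ht
    rcases ht.eq_or_lt with rfl | ht
    · rw [add_zero, semigroup_zero, mul_one]
    simp only [hD]
    rw [hsg t ht, hF.dunfordSg_add hη hηθ hs ht, hF.dunfordSgDeriv_add hη hηθ hs ht, hexp_add,
      smul_mul_smul_comm, add_mul, smul_mul_assoc]

end SectorialOperator

/-! ### Estimates in the intermediate space -/

section Intermediate

variable {X : Type*} [NormedAddCommGroup X] [NormedSpace ℂ X]
  {Y : Type*} [NormedAddCommGroup Y] [NormedSpace ℂ Y]

/-- `w` belongs to the space `Y`, viewed inside `X` through `ι`, and has `Y`-norm at most `c`. -/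
def HasLift (ι : Y →ₗ[ℂ] X) (w : X) (c : ℝ) : Prop := ∃ y : Y, ι y = w ∧ ‖y‖ ≤ c

namespace HasLift

variable {ι : Y →ₗ[ℂ] X} {v w : X} {c d : ℝ}

lemma mono (h : HasLift ι w c) (hcd : c ≤ d) : HasLift ι w d :=
  let ⟨y, h1, h2⟩ := h
  ⟨y, h1, h2.trans hcd⟩

lemma zero (ι : Y →ₗ[ℂ] X) : HasLift ι 0 0 := ⟨0, map_zero ι, norm_zero.le⟩

lemma add (hv : HasLift ι v c) (hw : HasLift ι w d) : HasLift ι (v + w) (c + d) :=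
  let ⟨y, h1, h2⟩ := hv
  let ⟨z, h3, h4⟩ := hw
  ⟨y + z, by rw [map_add, h1, h3], (norm_add_le y z).trans (add_le_add h2 h4)⟩

lemma sub (hv : HasLift ι v c) (hw : HasLift ι w d) : HasLift ι (v - w) (c + d) :=
  let ⟨y, h1, h2⟩ := hv
  let ⟨z, h3, h4⟩ := hw
  ⟨y - z, by rw [map_sub, h1, h3], (norm_sub_le y z).trans (add_le_add h2 h4)⟩

lemma smul (a : ℂ) (hw : HasLift ι w c) : HasLift ι (a • w) (‖a‖ * c) :=
  let ⟨y, h1, h2⟩ := hw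
  ⟨a • y, by rw [map_smul, h1], (norm_smul a y).le.trans
    (mul_le_mul_of_nonneg_left h2 (norm_nonneg a))⟩

lemma sum {κ : Type*} (s : Finset κ) {w : κ → X} {c : κ → ℝ}
    (h : ∀ i ∈ s, HasLift ι (w i) (c i)) : HasLift ι (∑ i ∈ s, w i) (∑ i ∈ s, c i) := by
  classical
  induction s using Finset.induction_on with
  | empty => simpa using HasLift.zero ι
  | insert i s hi ih =>
    rw [Finset.sum_insert hi, Finset.sum_insert hi]
    exact (h i (Finset.mem_insert_self i s)).add
      (ih fun j hj => h j (Finset.mem_insert_of_mem hj))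

end HasLift

variable {A : X →ₗ.[ℂ] X} {D : ℝ → X →L[ℂ] X}

/-- The integral of `s^{-α}` against the bounds `N (τ/s)^{(1-α)/2}` on `(0, τ)` and `N τ/s` on
`(τ, ∞)` is `O(N τ^{1-α})`: the first exponent makes the integral converge at `0`, the second at
`∞`. -/
lemma integrableOn_and_integral_norm_le_of_rpow_bounds {α τ N : ℝ}
    (hα : α ∈ Ioo (0 : ℝ) 1) (hτ : 0 < τ) (hN : 0 ≤ N) {f : ℝ → ℝ}
    (hf : AEStronglyMeasurable f (volume.restrict (Ioo 0 1)))
    (h1 : ∀ s ∈ Ioo (0 : ℝ) 1, s ≤ τ → ‖f s‖ ≤ s ^ (-α) * (N * (τ / s) ^ ((1 - α) / 2)))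
    (h2 : ∀ s ∈ Ioo (0 : ℝ) 1, τ < s → ‖f s‖ ≤ s ^ (-α) * (N * (τ / s))) :
    IntegrableOn f (Ioo 0 1) ∧
      ∫ s in Ioo (0 : ℝ) 1, ‖f s‖ ≤ N * τ ^ (1 - α) * (1 / ((1 - α) / 2) + 1 / α) := by
  obtain ⟨hα0, hα1⟩ := hα
  set κ := (1 - α) / 2 with hκ
  have hκ0 : 0 < κ := by rw [hκ]; linarith
  set b₁ : ℝ → ℝ := fun s => N * τ ^ κ * s ^ (κ - 1)
  set b₂ : ℝ → ℝ := fun s => N * τ * s ^ (-α - 1)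
  set b : ℝ → ℝ := fun s => if s ≤ τ then b₁ s else b₂ s
  have hb₁ : IntegrableOn b₁ (Ioc 0 τ) := by
    have h := (intervalIntegral.intervalIntegrable_rpow' (a := 0) (b := τ)
      (show -1 < κ - 1 by linarith)).const_mul (N * τ ^ κ)
    exact (intervalIntegrable_iff_integrableOn_Ioc_of_le hτ.le).1 h
  have hb₂ : IntegrableOn b₂ (Ioi τ) :=
    (integrableOn_Ioi_rpow_of_lt (by linarith) hτ).const_mul (N * τ)
  have hbe₁ : EqOn b₁ b (Ioc 0 τ) := fun s hs => (if_pos hs.2).symm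
  have hbe₂ : EqOn b₂ b (Ioi τ) := fun s hs => (if_neg (not_le.2 hs)).symm
  have hbi₁ : IntegrableOn b (Ioc 0 τ) := hb₁.congr_fun hbe₁ measurableSet_Ioc
  have hbi₂ : IntegrableOn b (Ioi τ) := hb₂.congr_fun hbe₂ measurableSet_Ioi
  have hbi : IntegrableOn b (Ioi 0) := by
    rw [← Ioc_union_Ioi_eq_Ioi hτ.le]
    exact hbi₁.union hbi₂
  have hbint : ∫ s in Ioi (0 : ℝ), b s = N * τ ^ (1 - α) * (1 / κ + 1 / α) := by
    rw [← Ioc_union_Ioi_eq_Ioi hτ.le,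
      setIntegral_union (Ioc_disjoint_Ioi le_rfl) measurableSet_Ioi hbi₁ hbi₂,
      ← setIntegral_congr_fun measurableSet_Ioc hbe₁,
      ← setIntegral_congr_fun measurableSet_Ioi hbe₂, integral_const_mul, integral_const_mul,
      integral_Ioi_rpow_of_lt (by linarith) hτ, ← intervalIntegral.integral_of_le hτ.le,
      integral_rpow (Or.inl (by linarith)), sub_add_cancel, sub_add_cancel,
      Real.zero_rpow hκ0.ne', sub_zero]
    have e1 : τ ^ κ * τ ^ κ = τ ^ (1 - α) := by
      rw [← Real.rpow_add hτ, hκ]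
      ring_nf
    have e2 : τ * τ ^ (-α) = τ ^ (1 - α) := by
      rw [sub_eq_add_neg, Real.rpow_add hτ, Real.rpow_one]
    calc _ = N * (τ ^ κ * τ ^ κ) * (1 / κ) + N * (τ * τ ^ (-α)) * (1 / α) := by
          field_simp
      _ = _ := by rw [e1, e2]; ring
  have hb0 : ∀ s ∈ Ioi (0 : ℝ), 0 ≤ b s := by
    intro s hs
    have hs0 : 0 < s := hs
    simp only [b, b₁, b₂]
    split_ifs <;> positivity
  have hfb : ∀ s ∈ Ioo (0 : ℝ) 1, ‖f s‖ ≤ b s := by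
    intro s hs
    have hs0 : 0 < s := hs.1
    by_cases h : s ≤ τ
    · refine (h1 s hs h).trans (le_of_eq ?_)
      simp only [b, b₁, if_pos h]
      have e : s ^ (κ - 1) = s ^ (-α) * (s ^ κ)⁻¹ := by
        rw [← Real.rpow_neg hs0.le, ← Real.rpow_add hs0, hκ]
        ring_nf
      rw [Real.div_rpow hτ.le hs0.le, e]
      ring
    · refine (h2 s hs (not_le.1 h)).trans (le_of_eq ?_)
      simp only [b, b₂, if_neg h]
      rw [Real.rpow_sub hs0, Real.rpow_one]
      ring
  have hbi' : IntegrableOn b (Ioo 0 1) := hbi.mono_set Ioo_subset_Ioi_self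
  have hfb' : ∀ᵐ s ∂volume.restrict (Ioo (0 : ℝ) 1), ‖f s‖ ≤ b s :=
    (ae_restrict_mem measurableSet_Ioo).mono hfb
  refine ⟨Integrable.mono' hbi' hf hfb', ?_⟩
  rw [← hbint]
  refine (integral_mono_ae (Integrable.mono' hbi' hf hfb').norm hbi' hfb').trans ?_
  exact setIntegral_mono_set hbi ((ae_restrict_mem measurableSet_Ioi).mono hb0)
    Ioo_subset_Ioi_self.eventuallyLE

/-- An element `w` for which `A e^{sA} w` is bounded by `N (τ/s)^{(1-α)/2}` for `s ≤ τ` and by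
`N τ/s` for `s > τ` has a norm `O(N τ^{1-α})` in `D_A(α, 1)`, hence in the intermediate space. -/
lemma IsAnalyticSemigroup.exists_hasLift_of_bound (hS : IsAnalyticSemigroup A D) {α : ℝ}
    (hα : α ∈ Ico (0 : ℝ) 1) {ι : Y →ₗ[ℂ] X} (hι : IsIntermediate A α ι) (T : ℝ) :
    ∃ C, 0 ≤ C ∧ ∀ τ ∈ Ioc 0 T, ∀ N ≥ 0, ∀ w : X, ‖w‖ ≤ N * τ →
      (∀ s ∈ Ioo (0 : ℝ) 1, s ≤ τ → ‖D s w‖ ≤ N * (τ / s) ^ ((1 - α) / 2)) →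
      (∀ s ∈ Ioo (0 : ℝ) 1, τ < s → ‖D s w‖ ≤ N * (τ / s)) →
      HasLift ι w (C * (N * τ ^ (1 - α))) := by
  obtain ⟨C₀, hC₀⟩ := hι.lower
  have hα1 : 0 < 1 - α := by linarith [hα.2]
  have hc : 0 ≤ 1 / ((1 - α) / 2) + 1 / α := by
    have := hα.1
    positivity
  refine ⟨|C₀| * (|T| ^ α + (1 / ((1 - α) / 2) + 1 / α)), by positivity, ?_⟩
  intro τ hτ N hN w hw h1 h2
  have hτ0 : 0 < τ := hτ.1
  have hnorm : N * τ ≤ N * τ ^ (1 - α) * |T| ^ α := by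
    have e : τ = τ ^ (1 - α) * τ ^ α := by
      rw [← Real.rpow_add hτ0, sub_add_cancel, Real.rpow_one]
    have h3 : τ ^ α ≤ |T| ^ α :=
      Real.rpow_le_rpow hτ0.le (hτ.2.trans (le_abs_self T)) hα.1
    calc N * τ = N * τ ^ (1 - α) * τ ^ α := by rw [mul_assoc, ← e]
      _ ≤ _ := by gcongr
  have key : w ∈ interpSpace A α 1 ∧ interpNorm A α 1 w ≤
      N * τ ^ (1 - α) * (|T| ^ α + (1 / ((1 - α) / 2) + 1 / α)) := by
    rcases hα.1.eq_or_lt with rfl | hα0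
    · refine ⟨Or.inl rfl, ?_⟩
      rw [interpNorm, if_pos rfl, mul_add]
      have : 0 ≤ N * τ ^ (1 - (0 : ℝ)) * (1 / ((1 - 0) / 2) + 1 / 0) := by positivity
      exact (hw.trans hnorm).trans (le_add_of_nonneg_right this)
    · have hf : ∀ s ∈ Ioo (0 : ℝ) 1, interpFun A α 1 w s = s ^ (-α) * ‖D s w‖ := by
        intro s hs
        rw [interpFun, hS.apply s hs.1, inv_one, ENNReal.toReal_one]
        ring_nf
      have hcont : ContinuousOn (interpFun A α 1 w) (Ioo 0 1) := by
        refine ContinuousOn.congr (ContinuousOn.mul ?_ ?_) hf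
        · exact fun s hs => (Real.continuousAt_rpow_const _ _ (Or.inl hs.1.ne')).continuousWithinAt
        · exact ((hS.contD.mono Ioo_subset_Ioi_self).clm_apply continuousOn_const).norm
      have hnf : ∀ s ∈ Ioo (0 : ℝ) 1, ‖interpFun A α 1 w s‖ = s ^ (-α) * ‖D s w‖ := by
        intro s hs
        rw [hf s hs, norm_mul, norm_norm, Real.norm_of_nonneg (Real.rpow_nonneg hs.1.le _)]
      have hm := hcont.aestronglyMeasurable measurableSet_Ioo (μ := volume)
      obtain ⟨h3, h4⟩ := integrableOn_and_integral_norm_le_of_rpow_bounds ⟨hα0, hα.2⟩ hτ0 hN hm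
        (fun s hs hsτ => by
          rw [hnf s hs]
          exact mul_le_mul_of_nonneg_left (h1 s hs hsτ) (Real.rpow_nonneg hs.1.le _))
        (fun s hs hsτ => by
          rw [hnf s hs]
          exact mul_le_mul_of_nonneg_left (h2 s hs hsτ) (Real.rpow_nonneg hs.1.le _))
      refine ⟨Or.inr (memLp_one_iff_integrable.2 h3), ?_⟩
      rw [interpNorm, if_neg hα0.ne', eLpNorm_one_eq_lintegral_enorm,
        ← integral_norm_eq_lintegral_enorm hm, mul_add]
      exact add_le_add (hw.trans hnorm) h4
  obtain ⟨y, hy, hyn⟩ := hC₀ w key.1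
  refine ⟨y, hy, hyn.trans ?_⟩
  have hpos : 0 ≤ N * τ ^ (1 - α) * (|T| ^ α + (1 / ((1 - α) / 2) + 1 / α)) := by positivity
  have h0 : 0 ≤ interpNorm A α 1 w := by
    rw [interpNorm]
    split_ifs <;> positivity
  calc C₀ * interpNorm A α 1 w ≤ |C₀| * interpNorm A α 1 w :=
        mul_le_mul_of_nonneg_right (le_abs_self _) h0
    _ ≤ |C₀| * _ := mul_le_mul_of_nonneg_left key.2 (abs_nonneg _)
    _ = _ := by ring

/-- The smoothing property `‖e^{σA} x‖_α = O(σ^{-α})`. -/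
lemma IsAnalyticSemigroup.exists_hasLift_semigroup (hS : IsAnalyticSemigroup A D) {α : ℝ}
    (hα : α ∈ Ico (0 : ℝ) 1) {ι : Y →ₗ[ℂ] X} (hι : IsIntermediate A α ι) (T : ℝ) :
    ∃ C, 0 ≤ C ∧ ∀ σ ∈ Ioc 0 T, ∀ x : X,
      HasLift ι (semigroup A σ x) (C * (‖x‖ * σ ^ (-α))) := by
  obtain ⟨C, hC, hlift⟩ := hS.exists_hasLift_of_bound hα hι T
  obtain ⟨K, hK, hbd⟩ := hS.bound (1 + T)
  refine ⟨C * K, by positivity, fun σ hσ x => ?_⟩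
  have hσ0 : 0 < σ := hσ.1
  have hDb : ∀ s ∈ Ioo (0 : ℝ) 1, ‖D s (semigroup A σ x)‖ ≤ K / (s + σ) * ‖x‖ := by
    intro s hs
    have e : D s (semigroup A σ x) = D (s + σ) x := by
      rw [hS.D_add s hs.1 σ hσ0.le]
      rfl
    rw [e]
    exact (D (s + σ)).le_of_opNorm_le
      (hbd (s + σ) ⟨by linarith [hs.1], by linarith [hs.2, hσ.2]⟩).2 x
  refine (hlift σ hσ (K * ‖x‖ / σ) (by positivity) _ ?_ ?_ ?_).mono (le_of_eq ?_)
  · rw [div_mul_cancel₀ _ hσ0.ne']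
    exact (semigroup A σ).le_of_opNorm_le (hbd σ ⟨hσ0, by linarith [hσ.2]⟩).1 x
  · intro s hs hsσ
    have hs0 : 0 < s := hs.1
    have h1 : 1 ≤ (σ / s) ^ ((1 - α) / 2) :=
      Real.one_le_rpow ((one_le_div hs0).2 hsσ) (by linarith [hα.2])
    calc _ ≤ K / (s + σ) * ‖x‖ := hDb s hs
      _ ≤ K / σ * ‖x‖ := by gcongr; linarith
      _ = K * ‖x‖ / σ * 1 := by ring
      _ ≤ _ := by gcongr
  · intro s hs hsσ
    have hs0 : 0 < s := hs.1
    calc _ ≤ K / (s + σ) * ‖x‖ := hDb s hs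
      _ ≤ K / s * ‖x‖ := by gcongr; linarith
      _ = _ := by field_simp
  · rw [Real.rpow_sub hσ0, Real.rpow_one, Real.rpow_neg hσ0.le]
    field_simp

/-- `‖∫₀^τ e^{σA} f(σ) dσ‖_α = O(τ^{1-α})` for bounded `f`. -/
lemma IsAnalyticSemigroup.exists_hasLift_integral [CompleteSpace X]
    (hS : IsAnalyticSemigroup A D) {α : ℝ}
    (hα : α ∈ Ico (0 : ℝ) 1) {ι : Y →ₗ[ℂ] X} (hι : IsIntermediate A α ι) (T : ℝ) :
    ∃ C, 0 ≤ C ∧ ∀ τ ∈ Ioc 0 T, ∀ (B : ℝ) (f : ℝ → X), (∀ σ ∈ Ioc 0 τ, ‖f σ‖ ≤ B) →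
      HasLift ι (∫ σ in (0 : ℝ)..τ, semigroup A σ (f σ)) (C * (B * τ ^ (1 - α))) := by
  obtain ⟨C, hC, hlift⟩ := hS.exists_hasLift_of_bound hα hι T
  obtain ⟨K, hK, hbd⟩ := hS.bound (1 + T)
  set κ := (1 - α) / 2 with hκ
  have hκ0 : 0 < κ := by rw [hκ]; linarith [hα.2]
  have hκ1 : κ ≤ 1 := by rw [hκ]; linarith [hα.1]
  refine ⟨C * (K / κ), by positivity, fun τ hτ B f hf => ?_⟩
  have hτ0 : 0 < τ := hτ.1
  have hB : 0 ≤ B := (norm_nonneg _).trans (hf τ ⟨hτ0, le_rfl⟩)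
  have hKκ : K * B ≤ K / κ * B :=
    mul_le_mul_of_nonneg_right (le_div_self hK hκ0 hκ1) hB
  have hN : 0 ≤ K / κ * B := by positivity
  by_cases hint : IntervalIntegrable (fun σ => semigroup A σ (f σ)) volume 0 τ
  swap
  -- Without integrability the Bochner integral vanishes and the bound is trivial.
  · rw [intervalIntegral.integral_undef hint]
    exact (HasLift.zero ι).mono (by positivity)
  have hDw : ∀ s ∈ Ioo (0 : ℝ) 1, D s (∫ σ in (0 : ℝ)..τ, semigroup A σ (f σ)) =
      ∫ σ in (0 : ℝ)..τ, D s (semigroup A σ (f σ)) := fun s _ =>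
    ((D s).intervalIntegral_comp_comm hint).symm
  have hDb : ∀ s ∈ Ioo (0 : ℝ) 1, ∀ σ ∈ Ioc 0 τ,
      ‖D s (semigroup A σ (f σ))‖ ≤ K / (s + σ) * B := by
    intro s hs σ hσ
    have e : D s (semigroup A σ (f σ)) = D (s + σ) (f σ) := by
      rw [hS.D_add s hs.1 σ hσ.1.le]
      rfl
    have hpos : 0 < s + σ := add_pos hs.1 hσ.1
    rw [e]
    refine ((D (s + σ)).le_of_opNorm_le (hbd (s + σ)
      ⟨hpos, by linarith [hs.2, hσ.2, hτ.2]⟩).2 _).trans ?_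
    exact mul_le_mul_of_nonneg_left (hf σ hσ) (by positivity)
  refine (hlift τ hτ (K / κ * B) hN _ ?_ ?_ ?_).mono (le_of_eq (by ring))
  · have h := intervalIntegral.norm_integral_le_of_norm_le_const (a := 0) (b := τ)
      (f := fun σ => semigroup A σ (f σ)) (C := K * B) (fun σ hσ => by
        rw [uIoc_of_le hτ0.le] at hσ
        exact ((semigroup A σ).le_of_opNorm_le
          (hbd σ ⟨hσ.1, by linarith [hσ.2, hτ.2]⟩).1 _).trans
          (mul_le_mul_of_nonneg_left (hf σ hσ) hK))
    rw [sub_zero, abs_of_pos hτ0] at h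
    exact h.trans (mul_le_mul_of_nonneg_right hKκ hτ0.le)
  · intro s hs hsτ
    have hs0 : 0 < s := hs.1
    rw [hDw s hs]
    have hi : IntervalIntegrable (fun σ => K * B * s ^ (-κ) * σ ^ (κ - 1)) volume 0 τ :=
      (intervalIntegral.intervalIntegrable_rpow' (by linarith)).const_mul _
    refine (intervalIntegral.norm_integral_le_of_norm_le hτ0.le (.of_forall fun σ hσ => ?_)
      hi).trans (le_of_eq ?_)
    · have hσ0 : 0 < σ := hσ.1
      refine (hDb s hs σ hσ).trans ?_
      -- Weighted comparison `s^κ σ^{1-κ} ≤ s + σ`.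
      have h1 : s ^ κ * σ ^ (1 - κ) ≤ s + σ := by
        calc s ^ κ * σ ^ (1 - κ) ≤ (s + σ) ^ κ * (s + σ) ^ (1 - κ) := by
              refine mul_le_mul (Real.rpow_le_rpow hs0.le (by linarith) hκ0.le)
                (Real.rpow_le_rpow hσ0.le (by linarith) (by linarith)) (by positivity)
                (by positivity)
          _ = s + σ := by
              rw [← Real.rpow_add (by positivity), add_sub_cancel, Real.rpow_one]
      have h2 : 1 / (s + σ) ≤ s ^ (-κ) * σ ^ (κ - 1) := by
        have e : s ^ (-κ) * σ ^ (κ - 1) = 1 / (s ^ κ * σ ^ (1 - κ)) := by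
          rw [← neg_sub, Real.rpow_neg hs0.le, Real.rpow_neg hσ0.le]
          field_simp
        rw [e]
        exact one_div_le_one_div_of_le (by positivity) h1
      calc K / (s + σ) * B = K * B * (1 / (s + σ)) := by ring
        _ ≤ K * B * (s ^ (-κ) * σ ^ (κ - 1)) := by gcongr
        _ = _ := by ring
    · rw [intervalIntegral.integral_const_mul, integral_rpow (Or.inl (by linarith)),
        sub_add_cancel, Real.zero_rpow hκ0.ne', sub_zero, Real.rpow_neg hs0.le,
        Real.div_rpow hτ0.le hs0.le]
      field_simp
  · intro s hs hsτ
    have hs0 : 0 < s := hs.1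
    rw [hDw s hs]
    have h := intervalIntegral.norm_integral_le_of_norm_le_const (a := 0) (b := τ)
      (f := fun σ => D s (semigroup A σ (f σ))) (C := K * B / s) (fun σ hσ => by
        rw [uIoc_of_le hτ0.le] at hσ
        refine (hDb s hs σ hσ).trans ?_
        calc K / (s + σ) * B ≤ K / s * B := by
              gcongr
              linarith [hσ.1]
          _ = K * B / s := by ring)
    rw [sub_zero, abs_of_pos hτ0] at h
    refine h.trans ?_
    calc K * B / s * τ = K * B * (τ / s) := by ring
      _ ≤ _ := by gcongr

end Intermediate

/-! ### Linear independence of the functions `φ_k` -/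

section Phi

lemma phi_recurrence (k : ℕ) (z : ℂ) : z * phi (k + 1) z = phi k z - 1 / (k.factorial : ℂ) := by
  have hE (ξ : ℝ) : HasDerivAt (fun ξ : ℝ => Complex.exp ((1 - ξ) * z))
      (Complex.exp ((1 - ξ) * z) * (-1 * z)) ξ := by
    have h : HasDerivAt (fun ξ : ℝ => (1 - (ξ : ℂ)) * z) (-1 * z) ξ :=
      ((Complex.ofRealCLM.hasDerivAt (x := ξ)).const_sub 1).mul_const z
    exact h.cexp
  cases k with
  | zero =>
    have h := intervalIntegral.integral_eq_sub_of_hasDerivAt (a := 0) (b := 1)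
      (fun ξ _ => hE ξ) (Continuous.intervalIntegrable (by fun_prop) _ _)
    have h2 : phi 1 z = ∫ ξ in (0 : ℝ)..1, Complex.exp ((1 - ξ) * z) := by
      simp [phi]
    rw [intervalIntegral.integral_mul_const, ← h2] at h
    simp only [Complex.ofReal_one, sub_self, zero_mul, Complex.exp_zero, Complex.ofReal_zero,
      sub_zero, one_mul] at h
    rw [zero_add, Nat.factorial_zero, Nat.cast_one, div_one]
    change z * phi 1 z = Complex.exp z - 1
    linear_combination -h
  | succ k =>
    have hP (ξ : ℝ) : HasDerivAt
        (fun ξ : ℝ => ((ξ ^ (k + 1) / ((k + 1).factorial : ℝ) : ℝ) : ℂ))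
        ((ξ ^ k / (k.factorial : ℝ) : ℝ) : ℂ) ξ := by
      have h : HasDerivAt (fun ξ : ℝ => ξ ^ (k + 1) / ((k + 1).factorial : ℝ))
          (ξ ^ k / (k.factorial : ℝ)) ξ := by
        refine ((hasDerivAt_pow (k + 1) ξ).div_const _).congr_deriv ?_
        have hk : (k.factorial : ℝ) ≠ 0 := by exact_mod_cast k.factorial_ne_zero
        rw [Nat.factorial_succ]
        rw [Nat.add_sub_cancel]
        push_cast
        have : (k : ℝ) + 1 ≠ 0 := by positivity
        field_simp
      exact h.ofReal_comp
    have hcont (j : ℕ) : Continuous fun ξ : ℝ =>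
        Complex.exp ((1 - ξ) * z) * ((ξ ^ j / (j.factorial : ℝ) : ℝ) : ℂ) := by fun_prop
    have h := intervalIntegral.integral_eq_sub_of_hasDerivAt (a := 0) (b := 1)
      (fun ξ _ => (hE ξ).mul (hP ξ)) (Continuous.intervalIntegrable (by fun_prop) _ _)
    have h2 : ∀ ξ : ℝ, Complex.exp ((1 - ξ) * z) * (-1 * z) *
        ((ξ ^ (k + 1) / ((k + 1).factorial : ℝ) : ℝ) : ℂ) +
        Complex.exp ((1 - ξ) * z) * ((ξ ^ k / (k.factorial : ℝ) : ℝ) : ℂ) =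
        -z * (Complex.exp ((1 - ξ) * z) * ((ξ ^ (k + 1) / ((k + 1).factorial : ℝ) : ℝ) : ℂ)) +
        Complex.exp ((1 - ξ) * z) * ((ξ ^ k / (k.factorial : ℝ) : ℝ) : ℂ) := fun ξ => by ring
    rw [intervalIntegral.integral_congr (fun ξ _ => h2 ξ),
      intervalIntegral.integral_add ((hcont (k + 1)).const_mul (-z) |>.intervalIntegrable _ _)
        ((hcont k).intervalIntegrable _ _), intervalIntegral.integral_const_mul] at h
    change -z * phi (k + 1 + 1) z + phi (k + 1) z = _ at h
    simp only [Pi.mul_apply, Complex.ofReal_one, sub_self, zero_mul, Complex.exp_zero, one_pow,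
      Complex.ofReal_div, Complex.ofReal_natCast, one_mul, zero_pow (Nat.succ_ne_zero k), zero_div,
      Complex.ofReal_zero, mul_zero, sub_zero] at h
    linear_combination -h

/-- `φ_k(x) ~ x^{-k} e^x` as `x → ∞`. -/
lemma tendsto_phi (k : ℕ) : Filter.Tendsto
    (fun x : ℝ => (x : ℂ) ^ k * Complex.exp (-x) * phi k x) Filter.atTop (nhds 1) := by
  induction k with
  | zero =>
    refine tendsto_const_nhds.congr fun x => ?_
    rw [pow_zero, one_mul, phi, ← Complex.exp_add, neg_add_cancel, Complex.exp_zero]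
  | succ k ih =>
    have h0 : Filter.Tendsto (fun x : ℝ => (x : ℂ) ^ k * Complex.exp (-x) * (1 / (k.factorial : ℂ)))
        Filter.atTop (nhds 0) := by
      have h := (Complex.continuous_ofReal.tendsto 0).comp
        (Real.tendsto_pow_mul_exp_neg_atTop_nhds_zero k)
      have h' := h.mul_const (1 / (k.factorial : ℂ))
      rw [Complex.ofReal_zero, zero_mul] at h'
      refine h'.congr fun x => ?_
      simp
    have h := ih.sub h0
    rw [sub_zero] at h
    refine h.congr fun x => ?_
    linear_combination -((x : ℂ) ^ k * Complex.exp (-x)) * phi_recurrence k x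

/-- The functions `φ_k` are linearly independent: after division by the leading function
`x^{-k} e^x` all terms of higher index vanish at infinity. -/
lemma eq_zero_of_sum_phi_eq_zero (c : ℕ →₀ ℂ) (h : ∀ z, (c.sum fun k a => a * phi k z) = 0) :
    c = 0 := by
  by_contra hc
  have hne : c.support.Nonempty := Finsupp.support_nonempty_iff.2 hc
  set k := c.support.min' hne with hk
  have hkmem : k ∈ c.support := Finset.min'_mem _ _
  have hterm : ∀ j ∈ c.support, Filter.Tendsto
      (fun x : ℝ => (x : ℂ) ^ k * Complex.exp (-x) * (c j * phi j x)) Filter.atTop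
      (nhds (if j = k then c j else 0)) := by
    intro j hj
    have hkj : k ≤ j := Finset.min'_le _ _ hj
    split_ifs with hjk
    · have h1 := (tendsto_phi k).const_mul (c j)
      rw [mul_one] at h1
      refine h1.congr fun x => ?_
      rw [hjk]
      ring
    · have hlt : 0 < j - k := by omega
      have h1 : Filter.Tendsto (fun x : ℝ => ((x : ℂ) ^ (j - k))⁻¹) Filter.atTop (nhds 0) := by
        have h2 := (Complex.continuous_ofReal.tendsto 0).comp
          (tendsto_inv_atTop_zero.comp (Filter.tendsto_pow_atTop (α := ℝ) hlt.ne'))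
        rw [Complex.ofReal_zero] at h2
        refine h2.congr fun x => ?_
        simp
      have h3 := (h1.mul (tendsto_phi j)).const_mul (c j)
      rw [zero_mul, mul_zero] at h3
      refine h3.congr' ?_
      filter_upwards [Filter.eventually_gt_atTop 0] with x hx
      have hx' : (x : ℂ) ≠ 0 := by exact_mod_cast hx.ne'
      have e : (x : ℂ) ^ j = (x : ℂ) ^ (j - k) * (x : ℂ) ^ k := by
        rw [← pow_add, Nat.sub_add_cancel hkj]
      rw [e]
      field_simp
  have hsum := tendsto_finsetSum c.support hterm
  have hzero : ∀ x : ℝ, ∑ j ∈ c.support, (x : ℂ) ^ k * Complex.exp (-x) * (c j * phi j x) = 0 := by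
    intro x
    rw [← Finset.mul_sum]
    have := h x
    rw [Finsupp.sum] at this
    rw [this, mul_zero]
  rw [Finset.sum_ite_eq' , if_pos hkmem] at hsum
  simp only [hzero] at hsum
  exact (Finsupp.mem_support_iff.1 hkmem) (tendsto_nhds_unique hsum tendsto_const_nhds)

/-- The order condition `∑ b_i = φ₁` for the scalar weights carries over to the operators. -/
lemma Method.sum_bOp {X : Type*} [NormedAddCommGroup X] [NormedSpace ℂ X] {s : ℕ} (m : Method s)
    (hm : ∀ z : ℂ, ∑ i : Fin s, m.b i z = phi 1 z) (A : X →ₗ.[ℂ] X) (τ : ℝ) :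
    ∑ i : Fin s, m.bOp A τ i = phiOp A τ 1 := by
  have h : ∑ i, m.coeff i = Finsupp.single 1 1 := by
    rw [← sub_eq_zero]
    refine eq_zero_of_sum_phi_eq_zero _ fun z => ?_
    rw [Finsupp.sum_sub_index (fun _ _ _ => sub_mul _ _ _), ← Finsupp.sum_finsetSum_index
      (fun _ => zero_mul _) (fun _ _ _ => add_mul _ _ _), Finsupp.sum_single_index (zero_mul _),
      one_mul, sub_eq_zero]
    exact hm z
  have h2 := Finsupp.sum_finsetSum_index (s := Finset.univ) (g := m.coeff)
    (h := fun k (a : ℂ) => a • phiOp A τ k) (fun _ => zero_smul _ _) (fun _ _ _ => add_smul _ _ _)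
  rw [h, Finsupp.sum_single_index (zero_smul ℂ (phiOp A τ 1)), one_smul] at h2
  exact h2

end Phi

/-! ### Bounds for the weights of the method -/

section Weights

variable {X : Type*} [NormedAddCommGroup X] [NormedSpace ℂ X]
  {A : X →ₗ.[ℂ] X} {D : ℝ → X →L[ℂ] X}

lemma intervalIntegrable_of_continuousOn_Ioo {F : Type*} [NormedAddCommGroup F] {f : ℝ → F}
    {a b C : ℝ} (hab : a ≤ b) (hc : ContinuousOn f (Ioo a b)) (hb : ∀ x ∈ Ioo a b, ‖f x‖ ≤ C) :
    IntervalIntegrable f volume a b := by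
  rw [intervalIntegrable_iff_integrableOn_Ioo_of_le hab]
  exact IntegrableOn.of_bound (by simp) (hc.aestronglyMeasurable measurableSet_Ioo) C
    ((ae_restrict_mem measurableSet_Ioo).mono hb)

lemma norm_phiWeight_le (k : ℕ) {ξ : ℝ} (h0 : 0 ≤ ξ) (h1 : ξ ≤ 1) :
    ‖((ξ ^ k / (k.factorial : ℝ) : ℝ) : ℂ)‖ ≤ 1 := by
  rw [Complex.norm_real, Real.norm_of_nonneg (by positivity)]
  exact div_le_one_of_le₀ ((pow_le_one₀ h0 h1).trans
    (by exact_mod_cast Nat.one_le_iff_ne_zero.2 k.factorial_ne_zero)) (by positivity)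

lemma IsAnalyticSemigroup.bound_Icc (hS : IsAnalyticSemigroup A D) (T : ℝ) :
    ∃ K, 0 ≤ K ∧ ∀ t ∈ Icc 0 T, ‖semigroup A t‖ ≤ K := by
  obtain ⟨K, hK, hbd⟩ := hS.bound T
  refine ⟨max K 1, le_max_of_le_left hK, fun t ht => ?_⟩
  rcases ht.1.eq_or_lt with rfl | h0
  · rw [semigroup_zero]
    exact ContinuousLinearMap.norm_id_le.trans (le_max_right _ _)
  · exact (hbd t ⟨h0, ht.2⟩).1.trans (le_max_left _ _)

lemma one_sub_mul_mem_Icc {T τ ξ : ℝ} (hτ : τ ∈ Ioc 0 T) (h0 : 0 ≤ ξ) (h1 : ξ ≤ 1) :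
    (1 - ξ) * τ ∈ Icc 0 T :=
  ⟨mul_nonneg (by linarith) hτ.1.le, (mul_le_of_le_one_left hτ.1.le (by linarith)).trans hτ.2⟩

lemma IsAnalyticSemigroup.exists_norm_phiOp_le (hS : IsAnalyticSemigroup A D) (T : ℝ) :
    ∃ K, 0 ≤ K ∧ ∀ τ ∈ Ioc 0 T, ∀ k, ‖phiOp A τ k‖ ≤ K := by
  obtain ⟨K, hK, hbd⟩ := hS.bound_Icc T
  refine ⟨K, hK, fun τ hτ k => ?_⟩
  cases k with
  | zero => exact hbd τ ⟨hτ.1.le, hτ.2⟩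
  | succ k =>
    have h := intervalIntegral.norm_integral_le_of_norm_le_const (a := 0) (b := 1) (C := K)
      (f := fun ξ : ℝ => ((ξ ^ k / (k.factorial : ℝ) : ℝ) : ℂ) • semigroup A ((1 - ξ) * τ))
      (fun ξ hξ => by
        rw [uIoc_of_le zero_le_one] at hξ
        rw [norm_smul]
        exact (mul_le_mul (norm_phiWeight_le k hξ.1.le hξ.2)
          (hbd _ (one_sub_mul_mem_Icc hτ hξ.1.le hξ.2)) (norm_nonneg _) zero_le_one).trans
          (one_mul K).le)
    rwa [sub_zero, abs_one, mul_one] at h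

lemma Method.exists_norm_bOp_le (hS : IsAnalyticSemigroup A D) {s : ℕ} (m : Method s) (T : ℝ) :
    ∃ K, 0 ≤ K ∧ ∀ τ ∈ Ioc 0 T, ∀ i, ‖m.bOp A τ i‖ ≤ K := by
  obtain ⟨K, hK, hbd⟩ := hS.exists_norm_phiOp_le T
  have hnn : ∀ i, 0 ≤ ∑ k ∈ (m.coeff i).support, ‖m.coeff i k‖ * K := fun i =>
    Finset.sum_nonneg fun _ _ => by positivity
  refine ⟨∑ i, ∑ k ∈ (m.coeff i).support, ‖m.coeff i k‖ * K,
    Finset.sum_nonneg fun i _ => hnn i, fun τ hτ i => ?_⟩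
  refine le_trans ?_ (Finset.single_le_sum (fun j _ => hnn j) (Finset.mem_univ i))
  rw [Method.bOp, Finsupp.sum]
  refine norm_sum_le_of_le _ fun k _ => ?_
  rw [norm_smul]
  exact mul_le_mul_of_nonneg_left (hbd τ hτ k) (norm_nonneg _)

/-- The operators `φ_{k+1}(τA)`, after the substitution `σ = (1 - ξ) τ`. -/
lemma IsAnalyticSemigroup.phiOp_succ_apply (hS : IsAnalyticSemigroup A D) {τ : ℝ} (hτ : 0 < τ)
    (k : ℕ) (x : X) : phiOp A τ (k + 1) x = (τ⁻¹ : ℝ) • ∫ σ in (0 : ℝ)..τ,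
      semigroup A σ ((((1 - σ / τ) ^ k / (k.factorial : ℝ) : ℝ) : ℂ) • x) := by
  obtain ⟨K, hK, hbd⟩ := hS.bound_Icc τ
  have hint : IntervalIntegrable (fun ξ : ℝ =>
      ((ξ ^ k / (k.factorial : ℝ) : ℝ) : ℂ) • semigroup A ((1 - ξ) * τ)) volume 0 1 := by
    refine intervalIntegrable_of_continuousOn_Ioo (C := K) zero_le_one ?_ fun ξ hξ => ?_
    · have h1 : Continuous fun ξ : ℝ => ((ξ ^ k / (k.factorial : ℝ) : ℝ) : ℂ) := by fun_prop
      have h2 : Continuous fun ξ : ℝ => (1 - ξ) * τ := by fun_prop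
      exact h1.continuousOn.smul (hS.cont.comp h2.continuousOn fun ξ hξ =>
        mul_pos (sub_pos.2 hξ.2) hτ)
    · rw [norm_smul]
      exact (mul_le_mul (norm_phiWeight_le k hξ.1.le hξ.2.le)
        (hbd _ (one_sub_mul_mem_Icc ⟨hτ, le_rfl⟩ hξ.1.le hξ.2.le)) (norm_nonneg _)
        zero_le_one).trans (one_mul K).le
  have h1 := intervalIntegral.integral_comp_sub_mul (a := 0) (b := 1) (fun σ : ℝ =>
    semigroup A σ ((((1 - σ / τ) ^ k / (k.factorial : ℝ) : ℝ) : ℂ) • x)) hτ.ne' τ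
  rw [mul_one, sub_self, mul_zero, sub_zero] at h1
  rw [← h1, phiOp, ContinuousLinearMap.intervalIntegral_apply hint]
  refine intervalIntegral.integral_congr fun ξ _ => ?_
  have e1 : 1 - (1 - ξ) * τ / τ = ξ := by rw [mul_div_cancel_right₀ _ hτ.ne', sub_sub_cancel]
  have e2 : τ - τ * ξ = (1 - ξ) * τ := by ring
  simp only [e2, e1, smul_apply, map_smul]

lemma IsAnalyticSemigroup.smul_phiOp_one_apply (hS : IsAnalyticSemigroup A D) {τ : ℝ}
    (hτ : 0 < τ) (x : X) : τ • phiOp A τ 1 x = ∫ σ in (0 : ℝ)..τ, semigroup A σ x := by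
  rw [hS.phiOp_succ_apply hτ 0 x, smul_smul, mul_inv_cancel₀ hτ.ne', one_smul]
  simp

variable [CompleteSpace X] {Y : Type*} [NormedAddCommGroup Y] [NormedSpace ℂ Y]

lemma IsAnalyticSemigroup.exists_hasLift_phiOp (hS : IsAnalyticSemigroup A D) {α : ℝ}
    (hα : α ∈ Ico (0 : ℝ) 1) {ι : Y →ₗ[ℂ] X} (hι : IsIntermediate A α ι) (T : ℝ) :
    ∃ C, 0 ≤ C ∧ ∀ τ ∈ Ioc 0 T, ∀ (k : ℕ) (x : X),
      HasLift ι (phiOp A τ k x) (C * (‖x‖ * τ ^ (-α))) := by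
  obtain ⟨C₁, hC₁, h1⟩ := hS.exists_hasLift_semigroup hα hι T
  obtain ⟨C₂, hC₂, h2⟩ := hS.exists_hasLift_integral hα hι T
  refine ⟨max C₁ C₂, le_max_of_le_left hC₁, fun τ hτ k x => ?_⟩
  have hτ0 : 0 < τ := hτ.1
  have hnn : 0 ≤ ‖x‖ * τ ^ (-α) := by positivity
  cases k with
  | zero => exact (h1 τ hτ x).mono (mul_le_mul_of_nonneg_right (le_max_left _ _) hnn)
  | succ k =>
    rw [hS.phiOp_succ_apply hτ0, ← Complex.coe_smul]
    refine ((h2 τ hτ ‖x‖ _ fun σ hσ => ?_).smul _).mono (le_trans (le_of_eq ?_)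
      (mul_le_mul_of_nonneg_right (le_max_right C₁ C₂) hnn))
    · rw [norm_smul]
      refine mul_le_of_le_one_left (norm_nonneg _) (norm_phiWeight_le k ?_ ?_)
      · rw [sub_nonneg, div_le_one hτ0]
        exact hσ.2
      · have : 0 ≤ σ / τ := div_nonneg hσ.1.le hτ0.le
        linarith
    · rw [Complex.norm_real, Real.norm_of_nonneg (inv_nonneg.2 hτ0.le), sub_eq_add_neg,
        Real.rpow_add hτ0, Real.rpow_one]
      field_simp

lemma Method.exists_hasLift_bOp (hS : IsAnalyticSemigroup A D) {s : ℕ} (m : Method s) {α : ℝ}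
    (hα : α ∈ Ico (0 : ℝ) 1) {ι : Y →ₗ[ℂ] X} (hι : IsIntermediate A α ι) (T : ℝ) :
    ∃ C, 0 ≤ C ∧ ∀ τ ∈ Ioc 0 T, ∀ (i : Fin s) (x : X),
      HasLift ι (m.bOp A τ i x) (C * (‖x‖ * τ ^ (-α))) := by
  obtain ⟨C, hC, h⟩ := hS.exists_hasLift_phiOp hα hι T
  have hnn : ∀ i, 0 ≤ ∑ k ∈ (m.coeff i).support, ‖m.coeff i k‖ * C := fun i =>
    Finset.sum_nonneg fun _ _ => by positivity
  refine ⟨∑ i, ∑ k ∈ (m.coeff i).support, ‖m.coeff i k‖ * C,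
    Finset.sum_nonneg fun i _ => hnn i, fun τ hτ i x => ?_⟩
  have hτ0 : 0 < τ := hτ.1
  have hle := Finset.single_le_sum (fun j _ => hnn j) (Finset.mem_univ i)
  have hx : 0 ≤ ‖x‖ * τ ^ (-α) := by positivity
  refine HasLift.mono ?_ (mul_le_mul_of_nonneg_right hle hx)
  rw [Method.bOp, Finsupp.sum, sum_apply, Finset.sum_mul]
  refine HasLift.sum _ fun k _ => ?_
  rw [smul_apply, mul_assoc]
  exact (h τ hτ k x).smul _

end Weights

/-! ### Local errors and their propagation -/

section Error

variable {X : Type*} [NormedAddCommGroup X] [NormedSpace ℂ X]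
  {A : X →ₗ.[ℂ] X} {D : ℝ → X →L[ℂ] X}

/-- `g` is bounded by `B` on `[0, T]` and differentiable on `(0, T]` with `‖g'(t)‖ ≤ B / t`. -/
structure IsAdmissibleForcing (g : ℝ → X) (T B : ℝ) : Prop where
  bdd : ∀ t ∈ Icc (0 : ℝ) T, ‖g t‖ ≤ B
  diff : ∀ t ∈ Ioc (0 : ℝ) T, DifferentiableWithinAt ℝ g (Icc 0 T) t ∧
    ‖derivWithin g (Icc 0 T) t‖ ≤ B / t

lemma IsAdmissibleForcing.continuousOn {g : ℝ → X} {T B : ℝ} (hg : IsAdmissibleForcing g T B) :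
    ContinuousOn g (Ioc 0 T) := fun t ht =>
  (hg.diff t ht).1.continuousWithinAt.mono Ioc_subset_Icc_self

/-- The oscillation of `g` over the `k`-th time step is `O(1/(k+1))`: for `k ≥ 1` by the bound on
the derivative, for `k = 0` by the bound on `g`. -/
lemma IsAdmissibleForcing.norm_sub_le {g : ℝ → X} {T B τ : ℝ} (hg : IsAdmissibleForcing g T B)
    (hτ : 0 < τ) {k : ℕ} (hk : ((k : ℝ) + 1) * τ ≤ T) {t : ℝ}
    (ht : t ∈ Icc (k * τ) ((k + 1) * τ)) : ‖g t - g ((k + 1) * τ)‖ ≤ 2 * B / (k + 1) := by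
  have hkτ : 0 ≤ (k : ℝ) * τ := by positivity
  have hmem : ((k : ℝ) + 1) * τ ∈ Icc 0 T := ⟨by positivity, hk⟩
  have hB : 0 ≤ B := (norm_nonneg _).trans (hg.bdd _ hmem)
  rcases Nat.eq_zero_or_pos k with rfl | hk0
  · refine (_root_.norm_sub_le _ _).trans ?_
    have h1 := hg.bdd t ⟨hkτ.trans ht.1, ht.2.trans hk⟩
    have h2 := hg.bdd _ hmem
    rw [Nat.cast_zero, zero_add, div_one] at *
    linarith
  · have hk1 : (1 : ℝ) ≤ k := by exact_mod_cast hk0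
    have hkτ0 : 0 < (k : ℝ) * τ := by positivity
    have hsub : Icc (k * τ) (((k : ℝ) + 1) * τ) ⊆ Icc 0 T := Icc_subset_Icc hkτ hk
    have h := (convex_Icc (k * τ) (((k : ℝ) + 1) * τ)).norm_image_sub_le_of_norm_hasDerivWithin_le
      (f := g) (f' := derivWithin g (Icc 0 T)) (C := B / (k * τ)) (x := ((k : ℝ) + 1) * τ) (y := t)
      (fun x hx => (hg.diff x ⟨hkτ0.trans_le hx.1, hx.2.trans hk⟩).1.hasDerivWithinAt.mono hsub)
      (fun x hx => (hg.diff x ⟨hkτ0.trans_le hx.1, hx.2.trans hk⟩).2.trans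
        (div_le_div_of_nonneg_left hB hkτ0 hx.1))
      ⟨ht.1.trans ht.2, le_rfl⟩ ht
    refine h.trans ?_
    have h1 : ‖t - ((k : ℝ) + 1) * τ‖ ≤ τ := by
      rw [Real.norm_eq_abs, abs_le]
      constructor <;> linarith [ht.1, ht.2]
    calc B / (k * τ) * ‖t - ((k : ℝ) + 1) * τ‖ ≤ B / (k * τ) * τ := by gcongr
      _ = B / k := by field_simp
      _ = 2 * B / (k + k) := by field_simp; ring
      _ ≤ 2 * B / (k + 1) := by gcongr

lemma IsAnalyticSemigroup.intervalIntegrable_convolution (hS : IsAnalyticSemigroup A D)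
    {g : ℝ → X} {T B t : ℝ} (hg : IsAdmissibleForcing g T B) (ht0 : 0 ≤ t) (htT : t ≤ T) :
    IntervalIntegrable (fun ξ => semigroup A (t - ξ) (g ξ)) volume 0 t := by
  obtain ⟨K, hK, hbd⟩ := hS.bound_Icc T
  refine intervalIntegrable_of_continuousOn_Ioo (C := K * B) ht0 ?_ fun ξ hξ => ?_
  · refine ContinuousOn.clm_apply (hS.cont.comp (by fun_prop) fun ξ hξ => sub_pos.2 hξ.2)
      (hg.continuousOn.mono fun ξ hξ => ⟨hξ.1, hξ.2.le.trans htT⟩)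
  · refine ((semigroup A (t - ξ)).le_of_opNorm_le
      (hbd _ ⟨(sub_pos.2 hξ.2).le, by linarith [hξ.1]⟩) _).trans ?_
    exact mul_le_mul_of_nonneg_left (hg.bdd ξ ⟨hξ.1.le, hξ.2.le.trans htT⟩) hK

/-- The defect of the exact solution in the `k`-th step of the method. -/
def Method.localError {s : ℕ} (m : Method s) (A : X →ₗ.[ℂ] X) (g : ℝ → X) (τ : ℝ) (k : ℕ) : X :=
  τ • ∑ i : Fin s, m.bOp A τ i (g (k * τ + m.c i * τ)) -
    ∫ σ in (0 : ℝ)..τ, semigroup A σ (g ((k + 1) * τ - σ))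

/-- The arguments of `g` in the `k`-th step lie in `[t_k, t_{k+1}]`. -/
lemma Method.node_mem_Icc {s : ℕ} (m : Method s) {τ : ℝ} (hτ : 0 < τ) (k : ℕ) (i : Fin s) :
    (k : ℝ) * τ + m.c i * τ ∈ Icc (k * τ) ((k + 1) * τ) := by
  obtain ⟨h0, h1⟩ := m.c_mem i
  have h2 : m.c i * τ ≤ 1 * τ := mul_le_mul_of_nonneg_right h1 hτ.le
  have h3 : 0 ≤ m.c i * τ := mul_nonneg h0 hτ.le
  constructor <;> linarith

/-- The local errors are `O(τ/(k+1))` in `X`. By `∑ b_i = φ₁` the method integrates constants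
exactly, so that `g` may be replaced by its deviation from the value `g(t_{k+1})`. -/
lemma Method.exists_norm_localError_le (hS : IsAnalyticSemigroup A D) {s : ℕ} (m : Method s)
    (hm : ∀ z : ℂ, ∑ i : Fin s, m.b i z = phi 1 z) (T : ℝ) :
    ∃ C, 0 ≤ C ∧ ∀ (B : ℝ) (g : ℝ → X), IsAdmissibleForcing g T B → ∀ τ > 0, ∀ k : ℕ,
      ((k : ℝ) + 1) * τ ≤ T → ‖m.localError A g τ k‖ ≤ C * (B * τ / (k + 1)) := by
  obtain ⟨K₁, hK₁, hb⟩ := m.exists_norm_bOp_le hS T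
  obtain ⟨K₂, hK₂, hbd⟩ := hS.bound_Icc T
  refine ⟨2 * (s * K₁ + K₂), by positivity, fun B g hg τ hτ k hk => ?_⟩
  have hkτ : 0 ≤ (k : ℝ) * τ := by positivity
  have hτT : τ ≤ T := by linarith
  have hmem : ((k : ℝ) + 1) * τ ∈ Icc 0 T := ⟨by positivity, hk⟩
  have hB : 0 ≤ B := (norm_nonneg _).trans (hg.bdd _ hmem)
  set v := g ((k + 1) * τ) with hv
  have hconst : τ • ∑ i, m.bOp A τ i v = ∫ σ in (0 : ℝ)..τ, semigroup A σ v := by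
    rw [← sum_apply, m.sum_bOp hm, hS.smul_phiOp_one_apply hτ]
  have hcontS : ContinuousOn (semigroup A) (Ioo 0 τ) := hS.cont.mono Ioo_subset_Ioi_self
  have hint1 : IntervalIntegrable (fun σ => semigroup A σ (g ((k + 1) * τ - σ))) volume 0 τ := by
    refine intervalIntegrable_of_continuousOn_Ioo (C := K₂ * B) hτ.le ?_ fun σ hσ => ?_
    · refine hcontS.clm_apply (hg.continuousOn.comp (by fun_prop) fun σ hσ => ?_)
      constructor <;> linarith [hσ.1, hσ.2]
    · refine ((semigroup A σ).le_of_opNorm_le (hbd σ ⟨hσ.1.le, hσ.2.le.trans hτT⟩) _).trans ?_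
      refine mul_le_mul_of_nonneg_left (hg.bdd _ ?_) hK₂
      constructor <;> linarith [hσ.1, hσ.2]
  have hint2 : IntervalIntegrable (fun σ => semigroup A σ v) volume 0 τ := by
    refine intervalIntegrable_of_continuousOn_Ioo (C := K₂ * ‖v‖) hτ.le
      (hcontS.clm_apply continuousOn_const) fun σ hσ => ?_
    exact (semigroup A σ).le_of_opNorm_le (hbd σ ⟨hσ.1.le, hσ.2.le.trans hτT⟩) _
  have hδ : m.localError A g τ k = τ • ∑ i, m.bOp A τ i (g (k * τ + m.c i * τ) - v) -
      ∫ σ in (0 : ℝ)..τ, semigroup A σ (g ((k + 1) * τ - σ) - v) := by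
    simp only [map_sub, Finset.sum_sub_distrib]
    rw [smul_sub, hconst, intervalIntegral.integral_sub hint1 hint2, Method.localError]
    abel
  have h1 : ‖τ • ∑ i, m.bOp A τ i (g (k * τ + m.c i * τ) - v)‖ ≤
      τ * (s * (K₁ * (2 * B / (k + 1)))) := by
    rw [norm_smul, Real.norm_of_nonneg hτ.le]
    refine mul_le_mul_of_nonneg_left ?_ hτ.le
    refine (norm_sum_le_of_le _ fun i _ => ?_ :
      _ ≤ ∑ _i : Fin s, K₁ * (2 * B / ((k : ℝ) + 1))).trans (le_of_eq ?_)
    · exact ((m.bOp A τ i).le_of_opNorm_le (hb τ ⟨hτ, hτT⟩ i) _).trans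
        (mul_le_mul_of_nonneg_left (hg.norm_sub_le hτ hk (m.node_mem_Icc hτ k i)) hK₁)
    · rw [Finset.sum_const, Finset.card_univ, Fintype.card_fin, nsmul_eq_mul]
  have h2 : ‖∫ σ in (0 : ℝ)..τ, semigroup A σ (g ((k + 1) * τ - σ) - v)‖ ≤
      K₂ * (2 * B / (k + 1)) * |τ - 0| := by
    refine intervalIntegral.norm_integral_le_of_norm_le_const fun σ hσ => ?_
    rw [uIoc_of_le hτ.le] at hσ
    refine ((semigroup A σ).le_of_opNorm_le (hbd σ ⟨hσ.1.le, hσ.2.trans hτT⟩) _).trans ?_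
    refine mul_le_mul_of_nonneg_left (hg.norm_sub_le hτ hk ?_) hK₂
    constructor <;> linarith [hσ.1, hσ.2]
  rw [sub_zero, abs_of_pos hτ] at h2
  rw [hδ]
  refine (norm_sub_le _ _).trans ((add_le_add h1 h2).trans (le_of_eq ?_))
  field_simp

variable [CompleteSpace X]

/-- The variation-of-constants formula over one time step. -/
lemma IsAnalyticSemigroup.mildSolution_step (hS : IsAnalyticSemigroup A D)
    {g : ℝ → X} {T B τ : ℝ} (hg : IsAdmissibleForcing g T B) (hτ : 0 < τ) {k : ℕ}
    (hk : ((k : ℝ) + 1) * τ ≤ T) (u₀ : X) :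
    mildSolution A g u₀ ((k + 1) * τ) = semigroup A τ (mildSolution A g u₀ (k * τ)) +
      ∫ σ in (0 : ℝ)..τ, semigroup A σ (g ((k + 1) * τ - σ)) := by
  have hkτ : 0 ≤ (k : ℝ) * τ := by positivity
  have hle : (k : ℝ) * τ ≤ (k + 1) * τ := by linarith
  have hint := hS.intervalIntegrable_convolution hg (hkτ.trans hle) hk
  have hint' := hS.intervalIntegrable_convolution hg hkτ (hle.trans hk)
  have hsplit := intervalIntegral.integral_add_adjacent_intervals
    (hint.mono_set (c := 0) (d := k * τ) (by
      rw [uIcc_of_le hkτ, uIcc_of_le (hkτ.trans hle)]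
      exact Icc_subset_Icc le_rfl hle))
    (hint.mono_set (c := k * τ) (d := (k + 1) * τ) (by
      rw [uIcc_of_le hle, uIcc_of_le (hkτ.trans hle)]
      exact Icc_subset_Icc hkτ le_rfl))
  have h1 : ∫ ξ in (0 : ℝ)..k * τ, semigroup A ((k + 1) * τ - ξ) (g ξ) =
      semigroup A τ (∫ ξ in (0 : ℝ)..k * τ, semigroup A (k * τ - ξ) (g ξ)) := by
    rw [← ContinuousLinearMap.intervalIntegral_comp_comm _ hint']
    refine intervalIntegral.integral_congr fun ξ hξ => ?_
    rw [uIcc_of_le hkτ] at hξ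
    have e : ((k : ℝ) + 1) * τ - ξ = τ + (k * τ - ξ) := by ring
    simp only [e, hS.add τ (k * τ - ξ) hτ.le (sub_nonneg.2 hξ.2), mul_apply_eq_comp]
  have h2 : ∫ ξ in (k * τ : ℝ)..(k + 1) * τ, semigroup A ((k + 1) * τ - ξ) (g ξ) =
      ∫ σ in (0 : ℝ)..τ, semigroup A σ (g ((k + 1) * τ - σ)) := by
    have h := intervalIntegral.integral_comp_sub_left (a := k * τ) (b := (k + 1) * τ)
      (fun σ => semigroup A σ (g ((k + 1) * τ - σ))) ((k + 1) * τ)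
    simp only [sub_sub_cancel, sub_self] at h
    rw [h]
    congr 1
    ring
  have h3 : semigroup A ((k + 1) * τ) u₀ = semigroup A τ (semigroup A (k * τ) u₀) := by
    have e : ((k : ℝ) + 1) * τ = τ + k * τ := by ring
    rw [e, hS.add τ (k * τ) hτ.le hkτ, mul_apply_eq_comp]
  rw [mildSolution, mildSolution, ← hsplit, h1, h2, h3, map_add, add_assoc]

/-- The global error is the sum of the propagated local errors. -/
lemma IsAnalyticSemigroup.numSol_sub_mildSolution (hS : IsAnalyticSemigroup A D) {s : ℕ}
    (m : Method s) {g : ℝ → X} {T B τ : ℝ} (hg : IsAdmissibleForcing g T B) (hτ : 0 < τ)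
    (u₀ : X) (n : ℕ) (hn : (n : ℝ) * τ ≤ T) :
    m.numSol A g u₀ τ n - mildSolution A g u₀ (n * τ) =
      ∑ k ∈ Finset.range n, semigroup A (((n : ℝ) - 1 - k) * τ) (m.localError A g τ k) := by
  induction n with
  | zero => simp [Method.numSol, mildSolution, semigroup_zero]
  | succ n ih =>
    have hn' : ((n : ℝ) + 1) * τ ≤ T := by exact_mod_cast hn
    have ih' := ih (by linarith)
    have hprop : ∑ k ∈ Finset.range n,
        semigroup A (((n + 1 : ℕ) - 1 - k : ℝ) * τ) (m.localError A g τ k) =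
        semigroup A τ (m.numSol A g u₀ τ n - mildSolution A g u₀ (n * τ)) := by
      rw [ih', map_sum]
      refine Finset.sum_congr rfl fun k hk => ?_
      have hkn : (k : ℝ) + 1 ≤ n := by exact_mod_cast Finset.mem_range.1 hk
      have e : (((n + 1 : ℕ) : ℝ) - 1 - k) * τ = τ + (n - 1 - k) * τ := by
        push_cast
        ring
      rw [e, hS.add τ _ hτ.le (mul_nonneg (by linarith) hτ.le), mul_apply_eq_comp]
    rw [Finset.sum_range_succ, hprop]
    have e0 : (((n + 1 : ℕ) : ℝ) - 1 - n) * τ = 0 := by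
      push_cast
      ring
    rw [e0, semigroup_zero, one_apply_eq_self, Method.numSol, Nat.cast_succ,
      hS.mildSolution_step hg hτ hn' u₀, map_sub, Method.localError]
    abel

variable {Y : Type*} [NormedAddCommGroup Y] [NormedSpace ℂ Y]

/-- The local errors are `O(τ^{1-α})` in the intermediate space. -/
lemma Method.exists_hasLift_localError (hS : IsAnalyticSemigroup A D) {s : ℕ} (m : Method s)
    {α : ℝ} (hα : α ∈ Ico (0 : ℝ) 1) {ι : Y →ₗ[ℂ] X} (hι : IsIntermediate A α ι) (T : ℝ) :
    ∃ C, 0 ≤ C ∧ ∀ (B : ℝ) (g : ℝ → X), IsAdmissibleForcing g T B → ∀ τ > 0, ∀ k : ℕ,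
      ((k : ℝ) + 1) * τ ≤ T → HasLift ι (m.localError A g τ k) (C * (B * τ ^ (1 - α))) := by
  obtain ⟨C₁, hC₁, h1⟩ := m.exists_hasLift_bOp hS hα hι T
  obtain ⟨C₂, hC₂, h2⟩ := hS.exists_hasLift_integral hα hι T
  refine ⟨s * C₁ + C₂, by positivity, fun B g hg τ hτ k hk => ?_⟩
  have hkτ : 0 ≤ (k : ℝ) * τ := by positivity
  have hτT : τ ≤ T := by linarith
  have e : τ ^ (1 - α) = τ * τ ^ (-α) := by
    rw [sub_eq_add_neg, Real.rpow_add hτ, Real.rpow_one]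
  have hsum : HasLift ι (τ • ∑ i, m.bOp A τ i (g (k * τ + m.c i * τ)))
      (s * C₁ * (B * τ ^ (1 - α))) := by
    rw [← Complex.coe_smul]
    refine ((HasLift.sum Finset.univ fun i _ => (h1 τ ⟨hτ, hτT⟩ i
      (g (k * τ + m.c i * τ))).mono (d := C₁ * (B * τ ^ (-α))) ?_).smul _).mono (le_of_eq ?_)
    · have hmem := m.node_mem_Icc hτ k i
      have := hg.bdd _ ⟨hkτ.trans hmem.1, hmem.2.trans hk⟩
      gcongr
    · rw [Finset.sum_const, Finset.card_univ, Fintype.card_fin, nsmul_eq_mul, Complex.norm_real,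
        Real.norm_of_nonneg hτ.le, e]
      ring
  refine (hsum.sub (h2 τ ⟨hτ, hτT⟩ B _ fun σ hσ => hg.bdd _ ?_)).mono (le_of_eq (by ring))
  constructor <;> linarith [hσ.1, hσ.2]

/-- The logarithm arises from `∑_{k < N} 1/(k+1) ≤ 1 + log N` with `N ≤ T/τ` steps. -/
lemma sum_inv_le_one_add_log {N : ℕ} {τ T : ℝ} (hτ : 0 < τ) (hT : 0 < T)
    (hN : (N : ℝ) * τ ≤ T) :
    ∑ k ∈ Finset.range N, (1 : ℝ) / (k + 1) ≤ 1 + |Real.log T| + |Real.log τ| := by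
  have h1 : ∑ k ∈ Finset.range N, (1 : ℝ) / (k + 1) = (harmonic N : ℝ) := by
    simp [harmonic]
  rw [h1]
  refine (harmonic_le_one_add_log N).trans ?_
  rcases Nat.eq_zero_or_pos N with rfl | hN0
  · rw [Nat.cast_zero, Real.log_zero]
    linarith [abs_nonneg (Real.log T), abs_nonneg (Real.log τ)]
  · have hN0' : (0 : ℝ) < N := by exact_mod_cast hN0
    have h2 := Real.log_le_log hN0' ((le_div_iff₀ hτ).2 hN)
    rw [Real.log_div hT.ne' hτ.ne'] at h2
    linarith [le_abs_self (Real.log T), neg_abs_le (Real.log τ)]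

/-- The global error bound: all propagated local errors but the last are estimated by smoothing,
and the last one directly in the intermediate space. -/
lemma Method.exists_hasLift_error (hS : IsAnalyticSemigroup A D) {s : ℕ} (m : Method s)
    (hm : ∀ z : ℂ, ∑ i : Fin s, m.b i z = phi 1 z) {α : ℝ} (hα : α ∈ Ico (0 : ℝ) 1)
    {ι : Y →ₗ[ℂ] X} (hι : IsIntermediate A α ι) {T : ℝ} (hT : 0 < T) :
    ∃ C, 0 ≤ C ∧ ∀ (B : ℝ) (g : ℝ → X), IsAdmissibleForcing g T B → ∀ τ > 0, ∀ (n : ℕ) (u₀ : X),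
      ((n : ℝ) + 1) * τ ≤ T →
      HasLift ι (m.numSol A g u₀ τ (n + 1) - mildSolution A g u₀ ((n + 1 : ℕ) * τ))
        (C * B * τ ^ (1 - α) * (|Real.log τ| + 1)) := by
  obtain ⟨C₁, hC₁, h1⟩ := hS.exists_hasLift_semigroup hα hι T
  obtain ⟨C₂, hC₂, h2⟩ := m.exists_norm_localError_le hS hm T
  obtain ⟨C₃, hC₃, h3⟩ := m.exists_hasLift_localError hS hα hι T
  refine ⟨C₁ * C₂ * (1 + |Real.log T|) + C₃, by positivity, fun B g hg τ hτ n u₀ hn => ?_⟩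
  have hB : 0 ≤ B := (norm_nonneg _).trans (hg.bdd 0 ⟨le_rfl, hT.le⟩)
  have e : τ ^ (1 - α) = τ * τ ^ (-α) := by
    rw [sub_eq_add_neg, Real.rpow_add hτ, Real.rpow_one]
  have hnτ : (n : ℝ) * τ ≤ T := by linarith
  rw [hS.numSol_sub_mildSolution m hg hτ u₀ (n + 1) (by exact_mod_cast hn),
    Finset.sum_range_succ]
  have e0 : (((n + 1 : ℕ) : ℝ) - 1 - n) * τ = 0 := by
    push_cast
    ring
  rw [e0, semigroup_zero, one_apply_eq_self]
  have hterm : ∀ k ∈ Finset.range n, HasLift ι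
      (semigroup A ((((n + 1 : ℕ) : ℝ) - 1 - k) * τ) (m.localError A g τ k))
      (C₁ * C₂ * B * τ ^ (1 - α) * (1 / (k + 1))) := by
    intro k hk
    have hkn : (k : ℝ) + 1 ≤ n := by exact_mod_cast Finset.mem_range.1 hk
    have hσ : τ ≤ (((n + 1 : ℕ) : ℝ) - 1 - k) * τ := by
      push_cast
      exact le_mul_of_one_le_left hτ.le (by linarith)
    have hσT : (((n + 1 : ℕ) : ℝ) - 1 - k) * τ ≤ T := by
      refine le_trans (mul_le_mul_of_nonneg_right ?_ hτ.le) hnτ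
      push_cast
      linarith [(k.cast_nonneg : (0 : ℝ) ≤ k)]
    have hkT : ((k : ℝ) + 1) * τ ≤ T := (mul_le_mul_of_nonneg_right hkn hτ.le).trans hnτ
    refine (h1 _ ⟨hτ.trans_le hσ, hσT⟩ _).mono ?_
    have hpow : ((((n + 1 : ℕ) : ℝ) - 1 - k) * τ) ^ (-α) ≤ τ ^ (-α) :=
      Real.rpow_le_rpow_of_nonpos hτ hσ (by linarith [hα.1])
    have hloc := h2 B g hg τ hτ k hkT
    have hpow0 := Real.rpow_nonneg (hτ.trans_le hσ).le (-α)
    calc C₁ * (‖m.localError A g τ k‖ * ((((n + 1 : ℕ) : ℝ) - 1 - k) * τ) ^ (-α))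
        ≤ C₁ * (C₂ * (B * τ / (k + 1)) * τ ^ (-α)) := by gcongr
      _ = _ := by
        rw [e]
        ring
  refine ((HasLift.sum _ hterm).add (h3 B g hg τ hτ n hn)).mono ?_
  rw [← Finset.mul_sum]
  have hsum := sum_inv_le_one_add_log hτ hT hnτ
  have hlog : 1 + |Real.log T| + |Real.log τ| ≤ (1 + |Real.log T|) * (|Real.log τ| + 1) := by
    nlinarith [abs_nonneg (Real.log T), abs_nonneg (Real.log τ)]
  have hP : 0 ≤ B * τ ^ (1 - α) := by positivity
  have hb1 := mul_le_mul_of_nonneg_left (hsum.trans hlog)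
    (show 0 ≤ C₁ * C₂ * B * τ ^ (1 - α) by positivity)
  have hb2 : C₃ * (B * τ ^ (1 - α)) ≤ C₃ * (B * τ ^ (1 - α)) * (|Real.log τ| + 1) :=
    le_mul_of_one_le_right (by positivity) (by linarith [abs_nonneg (Real.log τ)])
  calc _ ≤ _ := add_le_add hb1 hb2
    _ = _ := by ring

/-- The mild solution belongs to the intermediate space at positive times. -/
lemma IsAnalyticSemigroup.exists_eq_mildSolution (hS : IsAnalyticSemigroup A D) {α : ℝ}
    (hα : α ∈ Ico (0 : ℝ) 1) {ι : Y →ₗ[ℂ] X} (hι : IsIntermediate A α ι) {g : ℝ → X} {T B : ℝ}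
    (hg : IsAdmissibleForcing g T B) {t : ℝ} (ht : t ∈ Ioc 0 T) (u₀ : X) :
    ∃ z, ι z = mildSolution A g u₀ t := by
  obtain ⟨C₁, -, h1⟩ := hS.exists_hasLift_semigroup hα hι T
  obtain ⟨C₂, -, h2⟩ := hS.exists_hasLift_integral hα hι T
  have h := intervalIntegral.integral_comp_sub_left (a := 0) (b := t)
    (fun σ => semigroup A σ (g (t - σ))) t
  simp only [sub_sub_cancel, sub_self, sub_zero] at h
  obtain ⟨z, hz, -⟩ := (h1 t ht u₀).add (h2 t ht B (fun σ => g (t - σ)) fun σ hσ =>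
    hg.bdd _ ⟨sub_nonneg.2 hσ.2, by linarith [hσ.1, ht.2]⟩)
  exact ⟨z, by rw [hz, mildSolution, h]⟩

end Error

end ExpInt

end

theorem mainTheorem5
    {X : Type*} [NormedAddCommGroup X] [NormedSpace ℂ X] [CompleteSpace X]
    (A : X →ₗ.[ℂ] X) (hA : ExpInt.IsSectorial A)
    (α : ℝ) (hα : α ∈ Set.Ico (0 : ℝ) 1)
    {Y : Type*} [NormedAddCommGroup Y] [NormedSpace ℂ Y] [CompleteSpace Y]
    (ι : Y →ₗ[ℂ] X) (hι : ExpInt.IsIntermediate A α ι)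
    {s : ℕ} (m : ExpInt.Method s)
    (hm : ∀ z : ℂ, ∑ i : Fin s, m.b i z = ExpInt.phi 1 z)
    (T : ℝ) (hT : 0 < T) (B : ℝ) :
    ∃ C : ℝ, ∀ g : ℝ → X,
      (∀ t ∈ Set.Icc (0 : ℝ) T, ‖g t‖ ≤ B) →
      (∀ t ∈ Set.Ioc (0 : ℝ) T, DifferentiableWithinAt ℝ g (Set.Icc 0 T) t ∧
        ‖derivWithin g (Set.Icc 0 T) t‖ ≤ B / t) →
      ∀ (u₀ : Y) (τ : ℝ), 0 < τ → ∀ n : ℕ, (n : ℝ) * τ ≤ T →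
        ∃ y z : Y,
          ι y = m.numSol A g (ι u₀) τ n ∧
          ι z = ExpInt.mildSolution A g (ι u₀) (n * τ) ∧
          ‖y - z‖ ≤ C * τ ^ (1 - α) * (|Real.log τ| + 1) := by
  obtain ⟨D, hS⟩ := hA.exists_isAnalyticSemigroup
  obtain ⟨C, hC, herr⟩ := ExpInt.Method.exists_hasLift_error hS m hm hα hι hT
  refine ⟨C * |B|, fun g hg hg' u₀ τ hτ n hn => ?_⟩
  have hadm : ExpInt.IsAdmissibleForcing g T B := ⟨hg, hg'⟩
  cases n with
  | zero =>
    -- `e^{0A} = I`, so that no smoothing is available, and none is needed.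
    refine ⟨u₀, u₀, rfl, ?_, ?_⟩
    · simp [ExpInt.mildSolution, ExpInt.semigroup_zero]
    · rw [sub_self, norm_zero]
      positivity
  | succ n =>
    have hB : 0 ≤ B := (norm_nonneg _).trans (hg 0 ⟨le_rfl, hT.le⟩)
    obtain ⟨z, hz⟩ := hS.exists_eq_mildSolution hα hι hadm (t := (n + 1 : ℕ) * τ)
      ⟨by positivity, hn⟩ (ι u₀)
    obtain ⟨e, he, hle⟩ := herr B g hadm τ hτ n (ι u₀) (by exact_mod_cast hn)
    refine ⟨z + e, z, ?_, hz, ?_⟩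
    · rw [map_add, hz, he, add_sub_cancel]
    · rwa [add_sub_cancel_left, abs_of_nonneg hB]
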